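/- Let $H$ be a real Hilbert space and let $\Phi:H\to\mathbb R\cup\{\pm\infty\}$ be proper, convex and lower semicontinuous with $\operatorname{argmin}\Phi\neq\emptyset$. Put $\Phi^*=\min\Phi$ and $x^*=\operatorname{proj}_{\operatorname{argmin}\Phi}(0)$. For $\mu>0$ let $\Phi_\mu(x)=\inf_{y\in H}\{\Phi(y)+\frac1{2\mu}\|x-y\|^2\}$ be the Moreau envelope and $\operatorname{prox}_{\mu\Phi}(x)$ the unique minimizer in this infimum. For $e>0$ let $\varphi_{e,\mu}(x)=\Phi_\mu(x)+\frac e2\|x\|^2$ and let $x_{e,\mu}$ be its unique minimizer. Let $\alpha,\beta,t_0>0$, $1\le d<2$, $0\le l<d$, and $\lambda(t)=t^l$, $\varepsilon(t)=t^{-d}$. (1) There is $\gamma$ with $\frac\alpha2<\gamma<\alpha$ and $2\gamma(\alpha-\gamma)<1$. If $d>1$, or if $d=1$ and $\beta<1$, then for every such $\gamma$ there are $a,c>0$ such that $\lim_{t\to+\infty}\lambda(t)\varepsilon(t)=0$ and, for all sufficiently large $t$, $$\frac{d}{dt}\Big(\frac1{\sqrt{\varepsilon(t)}}\Big)\le\min\Big\{2\gamma-\alpha-\frac{\gamma\beta\dot\varepsilon(t)}{2\varepsilon(t)},\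 \alpha-\gamma\frac{a+1}{a}\Big\},$$ $$\Big(2\gamma(\alpha-\gamma)+\frac\gamma c-1\Big)\varepsilon(t)-\beta\dot\varepsilon(t)\le0,$$ $$2\beta\varepsilon^2(t)+\big(2-\gamma\beta\sqrt{\varepsilon(t)}\big)\dot\varepsilon(t)\le0,$$ $$\Big(\frac\gamma a+2(\alpha-\gamma)\Big)\beta^2\sqrt{\varepsilon(t)}-\frac{3\beta^2\dot\varepsilon(t)}{2\varepsilon(t)}-\dot\lambda(t)\le\beta.$$ (2) Let $x:[t_0,+\infty)\to H$ be any strong solution of $$\ddot x(t)+\alpha\sqrt{\varepsilon(t)}\,\dot x(t)+\beta\frac{d}{dt}\big(\nabla\Phi_{\lambda(t)}(x(t))\big)+\nabla\Phi_{\lambda(t)}(x(t))+\varepsilon(t)x(t)=0,$$ that is, $x$ is differentiable, $\dot x$ is locally absolutely continuous, and the equation holds for almost every $t$. For every $\gamma$ with $\frac\alpha2\le\gamma<\alpha$ and $2\gamma(\alpha-\gamma)<1$ let $$E(t)=\varphi_{\varepsilon(t),\lambda(t)}(x(t))-\varphi_{\varepsilon(t),\lambda(t)}(x_{\varepsilon(t),\lambda(t)})+\tfrac12\big\|\gamma\sqrt{\varepsilon(t)}\,(x(t)-x_{\varepsilon(t),\lambda(t)})+\dot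 x(t)+\beta\nabla\Phi_{\lambda(t)}(x(t))\big\|^2 .$$ Then there are $C_3,C_4,C_5>0$ and $t_2\ge t_0$ such that for all $t\ge t_2$ $$E(t)\le\frac{C_3}{t^{d/2+1}},$$ $$\Phi_{\lambda(t)}(x(t))-\Phi^*\le\frac{C_3}{t^{d/2+1}}+\frac{\|x^*\|^2}{2t^d}\quad\text{and}\quad\Phi_{\lambda(t)}(x(t))-\Phi^*\le\frac{C_4}{t^d},$$ $$\Phi\big(\operatorname{prox}_{\lambda(t)\Phi}(x(t))\big)-\Phi^*\le\frac{C_3}{t^{d/2+1}}+\frac{\|x^*\|^2}{2t^d}\quad\text{and}\quad\Phi\big(\operatorname{prox}_{\lambda(t)\Phi}(x(t))\big)-\Phi^*\le\frac{C_4}{t^d},$$ $$\|\operatorname{prox}_{\lambda(t)\Phi}(x(t))-x(t)\|^2\le 2C_3t^{l-d/2-1}+t^{l-d}\|x^*\|^2\quad\text{and}\quad\|\operatorname{prox}_{\lambda(t)\Phi}(x(t))-x(t)\|^2\le\frac{C_5}{t^{d-l}},$$ $$\|x(t)-x_{\varepsilon(t),\lambda(t)}\|^2\le\frac{C_3}{t^{1-d/2}},$$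 and, if $l\le\frac{3d}2-1$ or $x^*=0$, moreover $$\|\operatorname{prox}_{\lambda(t)\Phi}(x(t))-x(t)\|^2\le\frac{C_5}{t^{d/2+1-l}}.$$ Finally, $x(t)\to x^*$ strongly as $t\to+\infty$. -/

import Mathlib

open Set Filter Topology MeasureTheory

namespace TikhonovFlow

/-- A point of `S` at which `f` attains its minimum over `S`.  It is only applied to problems
that have exactly one minimizer. -/
noncomputable def argminOn {X R : Type*} [Nonempty X] [Preorder R] (f : X → R) (S : Set X) : X :=
  Classical.epsilon fun y => y ∈ S ∧ IsMinOn f S y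

section Functionals

variable {H : Type*} [NormedAddCommGroup H] [InnerProductSpace ℝ H]

/-- `Φ` is proper, convex (its epigraph is convex) and lower semicontinuous. -/
structure IsProperConvexLsc (Φ : H → EReal) : Prop where
  ne_bot : ∀ x, Φ x ≠ ⊥
  exists_ne_top : ∃ x, Φ x ≠ ⊤
  convex_epigraph : Convex ℝ {p : H × ℝ | Φ p.1 ≤ (p.2 : EReal)}
  lsc : LowerSemicontinuous Φ

/-- The set of global minimizers of `Φ`. -/
def argminSet (Φ : H → EReal) : Set H := {z | IsMinOn Φ univ z}

/-- The element of minimal norm of the set of global minimizers, i.e. the projection of `0`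
onto that set. -/
noncomputable def minNormMinimizer (Φ : H → EReal) : H :=
  argminOn (fun z : H => ‖z‖) (argminSet Φ)

/-- The objective `y ↦ Φ y + ‖x - y‖² / (2μ)`. -/
noncomputable def proxObjective (Φ : H → EReal) (μ : ℝ) (x y : H) : EReal :=
  Φ y + ((‖x - y‖ ^ 2 / (2 * μ) : ℝ) : EReal)

/-- The Moreau envelope of index `μ`; the infimum is finite for a proper function that is
bounded below. -/
noncomputable def moreau (Φ : H → EReal) (μ : ℝ) (x : H) : ℝ :=
  (⨅ y : H, proxObjective Φ μ x y).toReal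

/-- The proximal operator of parameter `μ`. -/
noncomputable def prox (Φ : H → EReal) (μ : ℝ) (x : H) : H :=
  argminOn (proxObjective Φ μ x) univ

/-- The regularized function `φ_{e,μ}(x) = Φ_μ(x) + e ‖x‖² / 2`. -/
noncomputable def regularized (Φ : H → EReal) (e μ : ℝ) (x : H) : ℝ :=
  moreau Φ μ x + e * ‖x‖ ^ 2 / 2

/-- The unique minimizer `x_{e,μ}` of the strongly convex function `φ_{e,μ}`. -/
noncomputable def regularizedMinimizer (Φ : H → EReal) (e μ : ℝ) : H :=
  argminOn (regularized Φ e μ) univ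

variable [CompleteSpace H]

/-- The velocity of a trajectory defined on `[t₀, ∞)`, one-sided at `t₀`. -/
noncomputable def velocity (t₀ : ℝ) (x : ℝ → H) (t : ℝ) : H := derivWithin x (Ici t₀) t

/-- `t ↦ ∇ Φ_{λ(t)} (x t)`. -/
noncomputable def envelopeGradient (Φ : H → EReal) (lam : ℝ → ℝ) (x : ℝ → H) (t : ℝ) : H :=
  gradient (moreau Φ (lam t)) (x t)

/-- `x` is a strong global solution on `[t₀, ∞)` of
`x'' + α √ε x' + β d/dt (∇ Φ_λ (x)) + ∇ Φ_λ (x) + ε x = 0`: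
it is differentiable, `x'` is locally absolutely continuous, and the equation holds at almost
every time, both derivatives in it existing. -/
structure IsStrongSolution (Φ : H → EReal) (lam eps : ℝ → ℝ) (α β t₀ : ℝ) (x : ℝ → H) :
    Prop where
  differentiableOn : DifferentiableOn ℝ x (Ici t₀)
  velocity_ac : ∀ T, t₀ ≤ T → AbsolutelyContinuousOnInterval (velocity t₀ x) t₀ T
  equation : ∀ᵐ t ∂(volume.restrict (Ioi t₀)), ∃ acc gradDot : H,
    HasDerivAt (velocity t₀ x) acc t ∧
    HasDerivAt (envelopeGradient Φ lam x) gradDot t ∧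
    acc + (α * √(eps t)) • velocity t₀ x t + β • gradDot
      + envelopeGradient Φ lam x t + eps t • x t = 0

/-- The energy function `E`. -/
noncomputable def energy (Φ : H → EReal) (lam eps : ℝ → ℝ) (β γ t₀ : ℝ) (x : ℝ → H) (t : ℝ) :
    ℝ :=
  regularized Φ (eps t) (lam t) (x t)
    - regularized Φ (eps t) (lam t) (regularizedMinimizer Φ (eps t) (lam t))
    + 1 / 2 * ‖(γ * √(eps t)) • (x t - regularizedMinimizer Φ (eps t) (lam t))
        + velocity t₀ x t + β • envelopeGradient Φ lam x t‖ ^ 2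

end Functionals

/-- The conditions on the parameter functions `λ`, `ε` and the constants under which the
Lyapunov analysis of `E` is carried out. -/
def ParameterConditions (lam eps : ℝ → ℝ) (α β γ a c : ℝ) : Prop :=
  Tendsto (fun t => lam t * eps t) atTop (𝓝 0) ∧
  ∀ᶠ t in atTop,
    deriv (fun s => 1 / √(eps s)) t
        ≤ min (2 * γ - α - γ * β * deriv eps t / (2 * eps t)) (α - γ * ((a + 1) / a)) ∧
    (2 * γ * (α - γ) + γ / c - 1) * eps t - β * deriv eps t ≤ 0 ∧
    2 * β * eps t ^ 2 + (2 - γ * β * √(eps t)) * deriv eps t ≤ 0 ∧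
    (γ / a + 2 * (α - γ)) * β ^ 2 * √(eps t) - 3 * β ^ 2 * deriv eps t / (2 * eps t)
        - deriv lam t ≤ β

/-- The smoothing parameter `λ(t) = t ^ l`. -/
noncomputable def polyLam (l : ℝ) (t : ℝ) : ℝ := t ^ l

/-- The Tikhonov parameter `ε(t) = 1 / t ^ d`. -/
noncomputable def polyEps (d : ℝ) (t : ℝ) : ℝ := 1 / t ^ d

end TikhonovFlow

/-!
By the semigroup property of Moreau envelopes, the minimizer of `Φ_μ + (e/2) ‖·‖²` is
`-(1/e) ∇Φ_{μ + 1/e}(0)`, and the minimal value is `Φ_{μ + 1/e}(0)`. The Tikhonov path is thereby a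
rescaled proximal path from the origin, which converges strongly to the minimizer of least norm and
moves at a speed controlled by the logarithmic derivatives of `ε` and `λ`.

Along a trajectory the energy satisfies `E' ≤ -(k/2) √ε E + C ε / t` almost everywhere, for some
`k > 0`. As `√ε = t ^ (-d/2)` with `d/2 < 1`, the dissipation rate dominates `1/t`, so that `E` is
of the order `(ε / t) / √ε = t ^ (-(d/2 + 1))`. Every other estimate follows because `E` bounds the
gap `φ(x) - min φ`, and by strong convexity and cocoercivity this gap bounds both
`(ε/2) ‖x - y‖²` and `(λ/2) ‖∇Φ_λ(x) + ε y‖²`, where `y` is the minimizer of `φ`.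
-/

namespace TikhonovFlow

open scoped InnerProductSpace

section Argmin

variable {X R : Type*} [Nonempty X] [Preorder R] {f : X → R} {S : Set X}

lemma argminOn_mem (h : ∃ y ∈ S, IsMinOn f S y) : argminOn f S ∈ S :=
  (Classical.epsilon_spec h).1

lemma isMinOn_argminOn (h : ∃ y ∈ S, IsMinOn f S y) : IsMinOn f S (argminOn f S) :=
  (Classical.epsilon_spec h).2

lemma argminOn_eq {p : X} (hp : p ∈ S) (hmin : IsMinOn f S p)
    (huniq : ∀ y ∈ S, f y ≤ f p → y = p) : argminOn f S = p :=
  have hex : ∃ y ∈ S, IsMinOn f S y := ⟨p, hp, hmin⟩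
  huniq _ (argminOn_mem hex) (isMinOn_argminOn hex hp)

end Argmin

section InnerProduct

variable {H : Type*} [NormedAddCommGroup H] [InnerProductSpace ℝ H]

lemma sq_norm_sub_midpoint (x u v : H) :
    ‖x - (1 / 2 : ℝ) • (u + v)‖ ^ 2
      = (‖x - u‖ ^ 2 + ‖x - v‖ ^ 2) / 2 - ‖u - v‖ ^ 2 / 4 := by
  have hpar := parallelogram_law_with_norm ℝ (x - u) (x - v)
  have hmid : x - (1 / 2 : ℝ) • (u + v) = (1 / 2 : ℝ) • ((x - u) + (x - v)) := by module
  rw [sub_sub_sub_cancel_left, norm_sub_rev] at hpar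
  rw [hmid, norm_smul, mul_pow]
  norm_num
  linarith

lemma sq_norm_sub_div_eq {μ : ℝ} (hμ : μ ≠ 0) (x p u : H) :
    ‖x - u‖ ^ 2 / (2 * μ)
      = ‖x - p‖ ^ 2 / (2 * μ) - ⟪(1 / μ) • (x - p), u - p⟫_ℝ + ‖u - p‖ ^ 2 / (2 * μ) := by
  rw [← sub_sub_sub_cancel_right x u p, norm_sub_sq_real, real_inner_smul_left]
  field_simp

end InnerProduct

section ProximalCost

variable {H : Type*} [NormedAddCommGroup H]

/-- The objective of the proximal problem at `x`, as a real function of a point `(u, b)` of the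
epigraph of `Φ`. Working on the epigraph keeps extended reals out of the minimization. -/
noncomputable def proxCost (μ : ℝ) (x : H) (p : H × ℝ) : ℝ := p.2 + ‖x - p.1‖ ^ 2 / (2 * μ)

variable [InnerProductSpace ℝ H] {μ : ℝ} {x : H}

lemma proxCost_midpoint (hμ : μ ≠ 0) (p q : H × ℝ) :
    proxCost μ x ((1 / 2 : ℝ) • (p + q))
      = (proxCost μ x p + proxCost μ x q) / 2 - ‖p.1 - q.1‖ ^ 2 / (8 * μ) := by
  simp only [proxCost, Prod.smul_fst, Prod.fst_add, Prod.smul_snd, Prod.snd_add,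
    sq_norm_sub_midpoint, smul_eq_mul]
  field_simp
  ring

variable {C : Set (H × ℝ)}

lemma sq_norm_fst_sub_le_of_proxCost_le (hconv : Convex ℝ C) (hμ : 0 < μ) {m δ : ℝ}
    (hm : ∀ p ∈ C, m ≤ proxCost μ x p) {p q : H × ℝ} (hp : p ∈ C) (hq : q ∈ C)
    (hpδ : proxCost μ x p ≤ m + δ) (hqδ : proxCost μ x q ≤ m + δ) :
    ‖p.1 - q.1‖ ^ 2 ≤ 8 * μ * δ := by
  have hmid : (1 / 2 : ℝ) • (p + q) ∈ C := by
    rw [smul_add]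
    exact hconv hp hq (by norm_num) (by norm_num) (by norm_num)
  have hle := hm _ hmid
  rw [proxCost_midpoint hμ.ne'] at hle
  rw [← div_le_iff₀' (by positivity)]
  linarith

/-- A minimizing sequence for a cost that is strongly convex in its first component converges. -/
lemma exists_isMinOn_proxCost [CompleteSpace H] (hconv : Convex ℝ C) (hclosed : IsClosed C)
    (hne : C.Nonempty) (hbdd : BddBelow (Prod.snd '' C)) (hμ : 0 < μ) (x : H) :
    ∃ p ∈ C, IsMinOn (proxCost μ x) C p := by
  have hcost : BddBelow (proxCost μ x '' C) := by
    obtain ⟨b, hb⟩ := hbdd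
    refine ⟨b, forall_mem_image.2 fun p hp => (hb (mem_image_of_mem _ hp)).trans ?_⟩
    exact le_add_of_nonneg_right (by positivity)
  obtain ⟨m, hm⟩ : ∃ m, IsGLB (proxCost μ x '' C) m := ⟨_, isGLB_csInf (hne.image _) hcost⟩
  have hmle : ∀ p ∈ C, m ≤ proxCost μ x p := fun p hp => hm.1 (mem_image_of_mem _ hp)
  have hnear : ∀ n : ℕ, ∃ p ∈ C, proxCost μ x p < m + 1 / ((n : ℝ) + 1) := fun n => by
    obtain ⟨_, ⟨p, hp, rfl⟩, -, hlt⟩ :=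
      hm.exists_between (lt_add_of_pos_right m (Nat.one_div_pos_of_nat (n := n)))
    exact ⟨p, hp, hlt⟩
  choose P hPC hPlt using hnear
  have hzero : Tendsto (fun n : ℕ => 1 / ((n : ℝ) + 1)) atTop (𝓝 0) :=
    tendsto_one_div_add_atTop_nhds_zero_nat
  have hcauchy : CauchySeq fun n => (P n).1 := by
    refine cauchySeq_of_le_tendsto_0 (fun N : ℕ => √(8 * μ * (1 / ((N : ℝ) + 1))))
      (fun i j N hi hj => ?_) (by simpa using (hzero.const_mul (8 * μ)).sqrt)
    rw [dist_eq_norm]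
    refine Real.le_sqrt_of_sq_le
      (sq_norm_fst_sub_le_of_proxCost_le hconv hμ hmle (hPC i) (hPC j) ?_ ?_)
    · exact (hPlt i).le.trans (by gcongr)
    · exact (hPlt j).le.trans (by gcongr)
  obtain ⟨y, hy⟩ := cauchySeq_tendsto_of_complete hcauchy
  have hvalue : Tendsto (fun n => proxCost μ x (P n)) atTop (𝓝 m) :=
    tendsto_of_tendsto_of_tendsto_of_le_of_le tendsto_const_nhds
      (by simpa using hzero.const_add m) (fun n => hmle _ (hPC n)) (fun n => (hPlt n).le)
  have hsnd : Tendsto (fun n => (P n).2) atTop (𝓝 (m - ‖x - y‖ ^ 2 / (2 * μ))) := by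
    simpa [proxCost] using
      hvalue.sub (((tendsto_const_nhds.sub hy).norm.pow 2).div_const (2 * μ) :
        Tendsto (fun n => ‖x - (P n).1‖ ^ 2 / (2 * μ)) atTop _)
  refine ⟨_, hclosed.mem_of_tendsto (hy.prodMk_nhds hsnd) (Eventually.of_forall hPC),
    fun p hp => ?_⟩
  simpa [proxCost] using hmle p hp

end ProximalCost

section Subgradient

variable {H : Type*} [NormedAddCommGroup H] [InnerProductSpace ℝ H] {Φ : H → EReal}

/-- `Φ` has the finite value `a` at `p` and `q` is a subgradient of `Φ` there. The subgradient
inequality is stated through real upper bounds `b` of `Φ u`, which avoids arithmetic in `EReal`. -/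
structure HasSubgradientAt (Φ : H → EReal) (a : ℝ) (q p : H) : Prop where
  value_eq : Φ p = a
  add_inner_le : ∀ ⦃u : H⦄ ⦃b : ℝ⦄, Φ u ≤ b → a + ⟪q, u - p⟫_ℝ ≤ b

namespace HasSubgradientAt

variable {a a' μ : ℝ} {p p' q q' x : H}

lemma ne_bot (h : HasSubgradientAt Φ a q p) (u : H) : Φ u ≠ ⊥ := fun hu => by
  have := h.add_inner_le (b := a + ⟪q, u - p⟫_ℝ - 1) (hu ▸ bot_le)
  linarith

lemma inner_sub_nonneg (h : HasSubgradientAt Φ a q p) (h' : HasSubgradientAt Φ a' q' p') :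
    0 ≤ ⟪q - q', p - p'⟫_ℝ := by
  have hp' := h.add_inner_le h'.value_eq.le
  have hp := h'.add_inner_le h.value_eq.le
  rw [← neg_sub p p', inner_neg_right] at hp'
  rw [inner_sub_left]
  linarith

lemma add_sq_div_le (h : HasSubgradientAt Φ a ((1 / μ) • (x - p)) p) (hμ : μ ≠ 0) {u : H} {b : ℝ}
    (hb : Φ u ≤ b) :
    a + ‖x - p‖ ^ 2 / (2 * μ) + ‖u - p‖ ^ 2 / (2 * μ) ≤ b + ‖x - u‖ ^ 2 / (2 * μ) := by
  have := h.add_inner_le hb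
  rw [sq_norm_sub_div_eq hμ x p u]
  linarith

lemma proxObjective_eq (h : HasSubgradientAt Φ a q p) :
    proxObjective Φ μ x p = ((a + ‖x - p‖ ^ 2 / (2 * μ) : ℝ) : EReal) := by
  rw [proxObjective, h.value_eq, EReal.coe_add]

lemma add_sq_div_le_proxObjective (h : HasSubgradientAt Φ a ((1 / μ) • (x - p)) p) (hμ : μ ≠ 0)
    (u : H) :
    ((a + ‖x - p‖ ^ 2 / (2 * μ) + ‖u - p‖ ^ 2 / (2 * μ) : ℝ) : EReal) ≤ proxObjective Φ μ x u := by
  rcases eq_or_ne (Φ u) ⊤ with hu | hu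
  · simp [proxObjective, hu]
  · have hcoe := EReal.coe_toReal hu (h.ne_bot u)
    rw [proxObjective, ← hcoe, ← EReal.coe_add, EReal.coe_le_coe_iff]
    exact h.add_sq_div_le hμ hcoe.ge

lemma isMinOn_proxObjective (h : HasSubgradientAt Φ a ((1 / μ) • (x - p)) p) (hμ : 0 < μ) :
    IsMinOn (proxObjective Φ μ x) univ p := fun u _ => by
  refine le_trans ?_ (h.add_sq_div_le_proxObjective hμ.ne' u)
  rw [h.proxObjective_eq, EReal.coe_le_coe_iff]
  exact le_add_of_nonneg_right (by positivity)

lemma prox_eq (h : HasSubgradientAt Φ a ((1 / μ) • (x - p)) p) (hμ : 0 < μ) :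
    prox Φ μ x = p := by
  refine argminOn_eq (mem_univ p) (h.isMinOn_proxObjective hμ) fun y _ hy => ?_
  have hle := (h.add_sq_div_le_proxObjective hμ.ne' y).trans hy
  rw [h.proxObjective_eq, EReal.coe_le_coe_iff, add_le_iff_nonpos_right,
    div_le_iff₀ (by positivity), zero_mul] at hle
  exact sub_eq_zero.1 (norm_eq_zero.1 (pow_eq_zero_iff two_ne_zero |>.1
    (hle.antisymm (sq_nonneg _))))

lemma moreau_eq (h : HasSubgradientAt Φ a ((1 / μ) • (x - p)) p) (hμ : 0 < μ) :
    moreau Φ μ x = a + ‖x - p‖ ^ 2 / (2 * μ) := by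
  have hinf : ⨅ y, proxObjective Φ μ x y = proxObjective Φ μ x p :=
    le_antisymm (iInf_le _ p) (le_iInf fun u => h.isMinOn_proxObjective hμ (mem_univ u))
  rw [moreau, hinf, h.proxObjective_eq, EReal.toReal_coe]

end HasSubgradientAt

lemma hasSubgradientAt_of_isMinOn_proxCost (hconv : Convex ℝ {p : H × ℝ | Φ p.1 ≤ (p.2 : EReal)})
    {μ a : ℝ} {x p : H} (hpa : Φ p ≤ a)
    (hmin : IsMinOn (proxCost μ x) {p : H × ℝ | Φ p.1 ≤ (p.2 : EReal)} (p, a)) (hμ : 0 < μ) :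
    HasSubgradientAt Φ a ((1 / μ) • (x - p)) p := by
  refine ⟨hpa.antisymm (le_of_not_gt fun hlt => ?_), fun u b hub => ?_⟩
  · obtain ⟨b, hpb, hba⟩ := EReal.lt_iff_exists_real_btwn.1 hlt
    have hle : proxCost μ x (p, a) ≤ proxCost μ x (p, b) := hmin hpb.le
    rw [EReal.coe_lt_coe_iff] at hba
    simp only [proxCost] at hle
    linarith
  · set D := ‖u - p‖ ^ 2 / (2 * μ)
    -- Compare the minimizer with the point at parameter `t` of the segment to `(u, b)`.
    have hsegment : ∀ t ∈ Ioc (0 : ℝ) 1, a + ⟪(1 / μ) • (x - p), u - p⟫_ℝ - b ≤ t * D := by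
      intro t ht
      have hmem := hconv (x := (p, a)) (y := (u, b)) hpa hub (sub_nonneg.2 ht.2) ht.1.le
        (sub_add_cancel 1 t)
      have hle : proxCost μ x (p, a) ≤ _ := hmin hmem
      simp only [proxCost, Prod.fst_add, Prod.smul_fst, Prod.snd_add, Prod.smul_snd,
        smul_eq_mul] at hle
      have hdir : (1 - t) • p + t • u - p = t • (u - p) := by module
      rw [sq_norm_sub_div_eq hμ.ne' x p ((1 - t) • p + t • u), hdir,
        norm_smul, mul_pow, Real.norm_eq_abs, sq_abs, real_inner_smul_right, mul_div_assoc] at hle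
      refine le_of_mul_le_mul_left ?_ ht.1
      linarith
    have hlim : Tendsto (fun t : ℝ => t * D) (𝓝[>] 0) (𝓝 0) := by
      simpa using ((continuous_mul_const D).tendsto 0).mono_left nhdsWithin_le_nhds
    have := ge_of_tendsto hlim (eventually_of_mem (Ioc_mem_nhdsGT one_pos) hsegment)
    linarith

omit [NormedAddCommGroup H] [InnerProductSpace ℝ H] in
lemma iInf_eq_of_mem_argminSet {z : H} (hz : z ∈ argminSet Φ) : ⨅ y, Φ y = Φ z :=
  le_antisymm (iInf_le _ z) (le_iInf fun u => hz (mem_univ u))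

namespace IsProperConvexLsc

lemma coe_toReal_iInf (hΦ : IsProperConvexLsc Φ) (hmin : (argminSet Φ).Nonempty) :
    (((⨅ y, Φ y).toReal : ℝ) : EReal) = ⨅ y, Φ y := by
  obtain ⟨z, hz⟩ := hmin
  obtain ⟨w, hw⟩ := hΦ.exists_ne_top
  refine EReal.coe_toReal (ne_top_of_le_ne_top hw (iInf_le _ w)) ?_
  rw [iInf_eq_of_mem_argminSet hz]
  exact hΦ.ne_bot z

lemma toReal_iInf_le (hΦ : IsProperConvexLsc Φ) (hmin : (argminSet Φ).Nonempty) {u : H} {b : ℝ}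
    (hb : Φ u ≤ b) : (⨅ y, Φ y).toReal ≤ b := by
  rw [← EReal.coe_le_coe_iff, hΦ.coe_toReal_iInf hmin]
  exact (iInf_le _ u).trans hb

lemma hasSubgradientAt_zero (hΦ : IsProperConvexLsc Φ) {z : H} (hz : z ∈ argminSet Φ) :
    HasSubgradientAt Φ (⨅ y, Φ y).toReal 0 z where
  value_eq := by rw [hΦ.coe_toReal_iInf ⟨z, hz⟩, iInf_eq_of_mem_argminSet hz]
  add_inner_le u b hb := by simpa using hΦ.toReal_iInf_le ⟨z, hz⟩ hb

lemma isClosed_epigraph (hΦ : IsProperConvexLsc Φ) :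
    IsClosed {p : H × ℝ | Φ p.1 ≤ (p.2 : EReal)} :=
  (lowerSemicontinuous_iff_isClosed_epigraph.1 hΦ.lsc).preimage
    (continuous_fst.prodMk (continuous_coe_real_ereal.comp continuous_snd))

lemma exists_hasSubgradientAt [CompleteSpace H] (hΦ : IsProperConvexLsc Φ)
    (hmin : (argminSet Φ).Nonempty) {μ : ℝ} (hμ : 0 < μ) (x : H) :
    ∃ p a, HasSubgradientAt Φ a ((1 / μ) • (x - p)) p := by
  have hne : {p : H × ℝ | Φ p.1 ≤ (p.2 : EReal)}.Nonempty := by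
    obtain ⟨z, hz⟩ := hmin
    exact ⟨(z, _), (hΦ.hasSubgradientAt_zero hz).value_eq.le⟩
  obtain ⟨⟨p, a⟩, hpa, hle⟩ := exists_isMinOn_proxCost hΦ.convex_epigraph hΦ.isClosed_epigraph
    hne ⟨_, forall_mem_image.2 fun _ hp => hΦ.toReal_iInf_le hmin hp⟩ hμ x
  exact ⟨p, a, hasSubgradientAt_of_isMinOn_proxCost hΦ.convex_epigraph hpa hle hμ⟩

end IsProperConvexLsc

end Subgradient

section Envelope

variable {H : Type*} [NormedAddCommGroup H] [InnerProductSpace ℝ H]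

/-- The Yosida approximation of the subdifferential, which is the gradient of the Moreau
envelope. -/
noncomputable def envGrad (Φ : H → EReal) (μ : ℝ) (x : H) : H := (1 / μ) • (x - prox Φ μ x)

/-- The value of `Φ` at the proximal point, as a real number. -/
noncomputable def proxValue (Φ : H → EReal) (μ : ℝ) (x : H) : ℝ := (Φ (prox Φ μ x)).toReal

variable {Φ : H → EReal} {μ ν : ℝ}

lemma sub_prox (hμ : μ ≠ 0) (x : H) : x - prox Φ μ x = μ • envGrad Φ μ x := by
  rw [envGrad, smul_smul, mul_one_div_cancel hμ, one_smul]

lemma prox_eq_sub (hμ : μ ≠ 0) (x : H) : prox Φ μ x = x - μ • envGrad Φ μ x := by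
  rw [← sub_prox hμ, sub_sub_cancel]

lemma sq_norm_sub_prox (hμ : μ ≠ 0) (x : H) :
    ‖x - prox Φ μ x‖ ^ 2 = μ ^ 2 * ‖envGrad Φ μ x‖ ^ 2 := by
  rw [sub_prox hμ, norm_smul, mul_pow, Real.norm_eq_abs, sq_abs]

namespace IsProperConvexLsc

section Argmin

variable {z : H} (hΦ : IsProperConvexLsc Φ) (hz : z ∈ argminSet Φ) (hμ : 0 < μ)
include hΦ hz hμ

lemma prox_of_mem_argminSet : prox Φ μ z = z :=
  HasSubgradientAt.prox_eq (by simpa using hΦ.hasSubgradientAt_zero hz) hμ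

lemma envGrad_of_mem_argminSet : envGrad Φ μ z = 0 := by
  rw [envGrad, hΦ.prox_of_mem_argminSet hz hμ, sub_self, smul_zero]

lemma moreau_of_mem_argminSet : moreau Φ μ z = (⨅ y, Φ y).toReal := by
  have h : HasSubgradientAt Φ (⨅ y, Φ y).toReal ((1 / μ) • (z - z)) z := by
    simpa using hΦ.hasSubgradientAt_zero hz
  simpa using h.moreau_eq hμ

end Argmin

variable [CompleteSpace H] (hΦ : IsProperConvexLsc Φ) (hmin : (argminSet Φ).Nonempty)
include hΦ hmin

lemma hasSubgradientAt_envGrad (hμ : 0 < μ) (x : H) :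
    HasSubgradientAt Φ (proxValue Φ μ x) (envGrad Φ μ x) (prox Φ μ x) := by
  obtain ⟨p, a, h⟩ := hΦ.exists_hasSubgradientAt hmin hμ x
  rwa [proxValue, envGrad, h.prox_eq hμ, h.value_eq, EReal.toReal_coe]

lemma moreau_eq (hμ : 0 < μ) (x : H) :
    moreau Φ μ x = proxValue Φ μ x + μ / 2 * ‖envGrad Φ μ x‖ ^ 2 := by
  rw [(hΦ.hasSubgradientAt_envGrad hmin hμ x).moreau_eq hμ, sq_norm_sub_prox hμ.ne']
  field_simp

lemma moreau_le (hμ : 0 < μ) {u : H} {b : ℝ} (hb : Φ u ≤ b) (x : H) :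
    moreau Φ μ x ≤ b + ‖x - u‖ ^ 2 / (2 * μ) := by
  have h := hΦ.hasSubgradientAt_envGrad hmin hμ x
  rw [h.moreau_eq hμ]
  exact (le_add_of_nonneg_right (by positivity)).trans (h.add_sq_div_le hμ.ne' hb)

lemma moreau_lower (hν : 0 < ν) (hμ : 0 < μ) (x x' : H) :
    moreau Φ ν x + ⟪envGrad Φ ν x, x' - x⟫_ℝ + (ν - μ) / 2 * ‖envGrad Φ ν x‖ ^ 2
      + μ / 2 * ‖envGrad Φ μ x' - envGrad Φ ν x‖ ^ 2 ≤ moreau Φ μ x' := by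
  have h := (hΦ.hasSubgradientAt_envGrad hmin hν x).add_inner_le
    (hΦ.hasSubgradientAt_envGrad hmin hμ x').value_eq.le
  have hprox : prox Φ μ x' - prox Φ ν x
      = (x' - x) + ν • envGrad Φ ν x - μ • envGrad Φ μ x' := by
    rw [prox_eq_sub hμ.ne', prox_eq_sub hν.ne']; abel
  rw [hprox, inner_sub_right, inner_add_right, inner_smul_right, inner_smul_right,
    real_inner_self_eq_norm_sq] at h
  rw [hΦ.moreau_eq hmin hν, hΦ.moreau_eq hmin hμ, norm_sub_sq_real,
    real_inner_comm (envGrad Φ ν x) (envGrad Φ μ x')]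
  linarith

lemma moreau_add_inner_le (hμ : 0 < μ) (x x' : H) :
    moreau Φ μ x + ⟪envGrad Φ μ x, x' - x⟫_ℝ
      + μ / 2 * ‖envGrad Φ μ x' - envGrad Φ μ x‖ ^ 2 ≤ moreau Φ μ x' := by
  simpa using hΦ.moreau_lower hmin hμ hμ x x'

lemma moreau_le_add_inner (hμ : 0 < μ) (x x' : H) :
    moreau Φ μ x' ≤ moreau Φ μ x + ⟪envGrad Φ μ x, x' - x⟫_ℝ + ‖x' - x‖ ^ 2 / (2 * μ) := by
  have h := hΦ.moreau_le hmin hμ (hΦ.hasSubgradientAt_envGrad hmin hμ x).value_eq.le x'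
  have hprox : ‖x' - prox Φ μ x‖ ^ 2
      = ‖x' - x‖ ^ 2 + 2 * (μ * ⟪envGrad Φ μ x, x' - x⟫_ℝ) + μ ^ 2 * ‖envGrad Φ μ x‖ ^ 2 := by
    rw [prox_eq_sub hμ.ne', ← sub_add, norm_add_sq_real, real_inner_smul_right, norm_smul,
      mul_pow, Real.norm_eq_abs, sq_abs, real_inner_comm]
  rw [hprox] at h
  rw [hΦ.moreau_eq hmin hμ x]
  refine h.trans_eq ?_
  field_simp
  ring

lemma envGrad_lipschitz (hν : 0 < ν) (hμ : 0 < μ) (x x' : H) :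
    ν * ‖envGrad Φ ν x - envGrad Φ μ x'‖ ≤ ‖x - x'‖ + |μ - ν| * ‖envGrad Φ μ x'‖ := by
  have hmono := (hΦ.hasSubgradientAt_envGrad hmin hν x).inner_sub_nonneg
    (hΦ.hasSubgradientAt_envGrad hmin hμ x')
  set q := envGrad Φ ν x
  set q' := envGrad Φ μ x'
  have hprox : prox Φ ν x - prox Φ μ x' = ((x - x') + (μ - ν) • q') - ν • (q - q') := by
    rw [prox_eq_sub hμ.ne', prox_eq_sub hν.ne']; module
  rw [hprox, inner_sub_right, inner_smul_right, real_inner_self_eq_norm_sq] at hmono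
  have htri : ‖(x - x') + (μ - ν) • q'‖ ≤ ‖x - x'‖ + |μ - ν| * ‖q'‖ := by
    refine (norm_add_le _ _).trans_eq ?_
    rw [norm_smul, Real.norm_eq_abs]
  have hinner := (real_inner_le_norm (q - q') ((x - x') + (μ - ν) • q')).trans
    (mul_le_mul_of_nonneg_left htri (norm_nonneg _))
  rcases (norm_nonneg (q - q')).eq_or_lt with h0 | h0
  · rw [← h0, mul_zero]; positivity
  · refine le_of_mul_le_mul_left ?_ h0
    linarith

omit hmin

lemma norm_envGrad_le {z : H} (hz : z ∈ argminSet Φ) (hμ : 0 < μ) (x : H) :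
    μ * ‖envGrad Φ μ x‖ ≤ ‖x - z‖ := by
  simpa [hΦ.envGrad_of_mem_argminSet hz hμ] using hΦ.envGrad_lipschitz ⟨z, hz⟩ hμ hμ x z

lemma mul_sq_norm_envGrad_le_inner {z : H} (hz : z ∈ argminSet Φ) (hμ : 0 < μ) (x : H) :
    μ * ‖envGrad Φ μ x‖ ^ 2 ≤ ⟪envGrad Φ μ x, x - z⟫_ℝ := by
  have hxz := hΦ.moreau_add_inner_le ⟨z, hz⟩ hμ x z
  have hzx := hΦ.moreau_add_inner_le ⟨z, hz⟩ hμ z x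
  rw [hΦ.envGrad_of_mem_argminSet hz hμ] at hxz hzx
  rw [zero_sub, norm_neg, ← neg_sub x z, inner_neg_right] at hxz
  rw [inner_zero_left, sub_zero] at hzx
  linarith

end IsProperConvexLsc

end Envelope

section Gradient

variable {H : Type*} [NormedAddCommGroup H] [InnerProductSpace ℝ H] [CompleteSpace H]

lemma hasGradientAt_of_abs_sub_le {f : H → ℝ} {g x : H} {C : ℝ}
    (h : ∀ x', |f x' - f x - ⟪g, x' - x⟫_ℝ| ≤ C * ‖x' - x‖ ^ 2) : HasGradientAt f g x := by
  rw [hasGradientAt_iff_isLittleO]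
  have hO : (fun x' => f x' - f x - ⟪g, x' - x⟫_ℝ) =O[𝓝 x] fun x' => ‖x' - x‖ ^ 2 :=
    .of_bound C (Eventually.of_forall fun x' => by simpa using h x')
  have hsub : Tendsto (fun x' : H => x' - x) (𝓝 x) (𝓝 0) := by
    simpa using (tendsto_id (x := 𝓝 x)).sub_const x
  exact hO.trans_isLittleO
    ((Asymptotics.isLittleO_norm_pow_id (E' := H) one_lt_two).comp_tendsto hsub)

lemma IsProperConvexLsc.gradient_moreau {Φ : H → EReal} (hΦ : IsProperConvexLsc Φ)
    (hmin : (argminSet Φ).Nonempty) {μ : ℝ} (hμ : 0 < μ) (x : H) :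
    gradient (moreau Φ μ) x = envGrad Φ μ x := by
  refine (hasGradientAt_of_abs_sub_le (C := 1 / (2 * μ)) fun x' => ?_).gradient
  have hlower := hΦ.moreau_add_inner_le hmin hμ x x'
  have hupper := hΦ.moreau_le_add_inner hmin hμ x x'
  have hquad : 0 ≤ μ / 2 * ‖envGrad Φ μ x' - envGrad Φ μ x‖ ^ 2 := by positivity
  rw [one_div_mul_eq_div, abs_le]
  constructor <;> linarith

end Gradient

section MinNorm

lemma cauchySeq_of_sq_dist_le_sub {β X : Type*} [SemilatticeSup β] [Nonempty β]
    [PseudoMetricSpace X] {Z : β → X} {N : β → ℝ} (hbdd : BddAbove (range N))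
    (hdist : ∀ r s, r ≤ s → dist (Z r) (Z s) ^ 2 ≤ N s - N r) : CauchySeq Z := by
  have hmono : Monotone N := fun r s hrs =>
    sub_nonneg.1 ((sq_nonneg _).trans (hdist r s hrs))
  have hlim := tendsto_atTop_ciSup hmono hbdd
  set G := ⨆ s, N s
  have hdist' : ∀ r s, r ≤ s → dist (Z r) (Z s) ≤ √(G - N r) := fun r s hrs =>
    Real.le_sqrt_of_sq_le ((hdist r s hrs).trans (sub_le_sub_right (le_ciSup hbdd s) _))
  refine cauchySeq_of_le_tendsto_0 (fun r => 2 * √(G - N r)) (fun n m r hn hm => ?_) ?_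
  · have := dist_triangle_left (Z n) (Z m) (Z r)
    linarith [hdist' r n hn, hdist' r m hm]
  · simpa using ((hlim.const_sub G).sqrt).const_mul 2

variable {H : Type*} [NormedAddCommGroup H] [InnerProductSpace ℝ H] {Φ : H → EReal}

lemma prox_zero (Φ : H → EReal) {s : ℝ} (hs : s ≠ 0) : prox Φ s 0 = -(s • envGrad Φ s 0) := by
  rw [prox_eq_sub hs, zero_sub]

namespace IsProperConvexLsc

lemma convex_argminSet (hΦ : IsProperConvexLsc Φ) : Convex ℝ (argminSet Φ) := by
  intro u hu v hv a b ha hb hab w _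
  set m := (⨅ y, Φ y).toReal
  have hconv : Φ (a • u + b • v) ≤ ((a • m + b • m : ℝ) : EReal) :=
    hΦ.convex_epigraph (x := (u, m)) (y := (v, m)) (hΦ.hasSubgradientAt_zero hu).value_eq.le
      (hΦ.hasSubgradientAt_zero hv).value_eq.le ha hb hab
  rw [← add_smul, hab, one_smul, hΦ.coe_toReal_iInf ⟨u, hu⟩] at hconv
  exact hconv.trans (iInf_le _ w)

lemma isClosed_argminSet (hΦ : IsProperConvexLsc Φ) : IsClosed (argminSet Φ) := by
  have hinter : argminSet Φ = ⋂ w, Φ ⁻¹' Iic (Φ w) := by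
    ext z; simp [argminSet, IsMinOn, IsMinFilter]
  rw [hinter]
  exact isClosed_iInter fun w => hΦ.lsc.isClosed_preimage _

variable [CompleteSpace H] (hΦ : IsProperConvexLsc Φ) (hmin : (argminSet Φ).Nonempty)
include hΦ

include hmin in
lemma exists_isMinOn_norm :
    ∃ z ∈ argminSet Φ, IsMinOn (fun z : H => ‖z‖) (argminSet Φ) z := by
  obtain ⟨z, hz, hinf⟩ := exists_norm_eq_iInf_of_complete_convex hmin
    hΦ.isClosed_argminSet.isComplete hΦ.convex_argminSet 0
  have hbdd : BddBelow (range fun w : argminSet Φ => ‖(0 : H) - w‖) :=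
    ⟨0, forall_mem_range.2 fun _ => norm_nonneg _⟩
  refine ⟨z, hz, fun w hw => ?_⟩
  have hle := hinf.trans_le (ciInf_le hbdd ⟨w, hw⟩)
  rwa [zero_sub, zero_sub, norm_neg, norm_neg] at hle

include hmin in
lemma minNormMinimizer_mem : minNormMinimizer Φ ∈ argminSet Φ :=
  argminOn_mem (hΦ.exists_isMinOn_norm hmin)

lemma norm_minNormMinimizer_le {z : H} (hz : z ∈ argminSet Φ) : ‖minNormMinimizer Φ‖ ≤ ‖z‖ :=
  isMinOn_argminOn (hΦ.exists_isMinOn_norm ⟨z, hz⟩) hz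

lemma eq_minNormMinimizer {z : H} (hz : z ∈ argminSet Φ) (hnorm : ‖z‖ ≤ ‖minNormMinimizer Φ‖) :
    z = minNormMinimizer Φ := by
  have hmid : (1 / 2 : ℝ) • (z + minNormMinimizer Φ) ∈ argminSet Φ := by
    rw [smul_add]
    exact hΦ.convex_argminSet hz (hΦ.minNormMinimizer_mem ⟨z, hz⟩) (by norm_num) (by norm_num)
      (by norm_num)
  have hle := pow_le_pow_left₀ (norm_nonneg _) (hΦ.norm_minNormMinimizer_le hmid) 2
  have hpar := sq_norm_sub_midpoint 0 z (minNormMinimizer Φ)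
  simp only [zero_sub, norm_neg] at hpar
  have hsq := pow_le_pow_left₀ (norm_nonneg _) hnorm 2
  have hzero : ‖z - minNormMinimizer Φ‖ ^ 2 = 0 := le_antisymm (by linarith) (sq_nonneg _)
  exact sub_eq_zero.1 (norm_eq_zero.1 (pow_eq_zero_iff two_ne_zero |>.1 hzero))

include hmin

lemma norm_envGrad_zero_le {s : ℝ} (hs : 0 < s) :
    s * ‖envGrad Φ s 0‖ ≤ ‖minNormMinimizer Φ‖ := by
  simpa using hΦ.norm_envGrad_le (hΦ.minNormMinimizer_mem hmin) hs 0

lemma norm_prox_zero_le {s : ℝ} (hs : 0 < s) : ‖prox Φ s 0‖ ≤ ‖minNormMinimizer Φ‖ := by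
  rw [prox_zero Φ hs.ne', norm_neg, norm_smul, Real.norm_of_nonneg hs.le]
  exact hΦ.norm_envGrad_zero_le hmin hs

lemma sq_dist_prox_zero_le {r s : ℝ} (hr : 0 < r) (hrs : r ≤ s) :
    dist (prox Φ r 0) (prox Φ s 0) ^ 2 ≤ ‖prox Φ s 0‖ ^ 2 - ‖prox Φ r 0‖ ^ 2 := by
  rcases hrs.eq_or_lt with rfl | hlt
  · simp
  have hs := hr.trans hlt
  set z := prox Φ r 0 with hz
  set d := prox Φ s 0 - z with hd
  have hs_eq : prox Φ s 0 = z + d := (add_sub_cancel _ _).symm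
  have hmono := (hΦ.hasSubgradientAt_envGrad hmin hs 0).inner_sub_nonneg
    (hΦ.hasSubgradientAt_envGrad hmin hr 0)
  rw [envGrad, envGrad, zero_sub, zero_sub, ← hz, ← hd, hs_eq, smul_neg, smul_neg,
    sub_neg_eq_add, inner_add_left, inner_neg_left, real_inner_smul_left, real_inner_smul_left,
    inner_add_left, real_inner_self_eq_norm_sq] at hmono
  have hscaled : r * ‖d‖ ^ 2 ≤ (s - r) * ⟪z, d⟫_ℝ := by
    have := mul_nonneg (mul_pos hr hs).le hmono
    field_simp at this
    linarith
  have hinner : 0 ≤ ⟪z, d⟫_ℝ :=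
    nonneg_of_mul_nonneg_right (le_trans (by positivity) hscaled) (sub_pos.2 hlt)
  rw [dist_comm, dist_eq_norm, hs_eq, add_sub_cancel_left, norm_add_sq_real]
  linarith

lemma exists_tendsto_prox_zero : ∃ p, Tendsto (fun s => prox Φ s 0) atTop (𝓝 p) := by
  have hpos : ∀ s : ℝ, 0 < max s 1 := fun s => lt_max_of_lt_right one_pos
  have hcauchy : CauchySeq fun s : ℝ => prox Φ (max s 1) 0 := by
    refine cauchySeq_of_sq_dist_le_sub (N := fun s => ‖prox Φ (max s 1) 0‖ ^ 2)
      ⟨‖minNormMinimizer Φ‖ ^ 2, forall_mem_range.2 fun s => ?_⟩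
      fun r s hrs => hΦ.sq_dist_prox_zero_le hmin (hpos r) (max_le_max_right 1 hrs)
    exact pow_le_pow_left₀ (norm_nonneg _) (hΦ.norm_prox_zero_le hmin (hpos s)) 2
  obtain ⟨p, hp⟩ := cauchySeq_tendsto_of_complete hcauchy
  refine ⟨p, hp.congr' ?_⟩
  filter_upwards [eventually_ge_atTop 1] with s hs
  rw [max_eq_left hs]

lemma proxValue_zero_le {s : ℝ} (hs : 0 < s) :
    proxValue Φ s 0 ≤ (⨅ y, Φ y).toReal + ‖minNormMinimizer Φ‖ ^ 2 / (2 * s) := by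
  have hmoreau := hΦ.moreau_le hmin hs
    (hΦ.hasSubgradientAt_zero (hΦ.minNormMinimizer_mem hmin)).value_eq.le 0
  rw [hΦ.moreau_eq hmin hs, zero_sub, norm_neg] at hmoreau
  exact (le_add_of_nonneg_right (by positivity)).trans hmoreau

lemma mem_argminSet_of_tendsto_prox_zero {p : H}
    (hp : Tendsto (fun s => prox Φ s 0) atTop (𝓝 p)) : p ∈ argminSet Φ := by
  have hbound : Tendsto (fun s : ℝ => (⨅ y, Φ y).toReal + ‖minNormMinimizer Φ‖ ^ 2 / (2 * s))
      atTop (𝓝 (⨅ y, Φ y).toReal) := by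
    have : Tendsto (fun s : ℝ => ‖minNormMinimizer Φ‖ ^ 2 / (2 * s)) atTop (𝓝 0) :=
      tendsto_const_nhds.div_atTop (tendsto_id.const_mul_atTop two_pos)
    simpa using this.const_add (⨅ y, Φ y).toReal
  have hle : Φ p ≤ ((⨅ y, Φ y).toReal : ℝ) := by
    refine hΦ.isClosed_epigraph.mem_of_tendsto (hp.prodMk_nhds hbound) ?_
    filter_upwards [eventually_gt_atTop 0] with s hs
    rw [(hΦ.hasSubgradientAt_envGrad hmin hs 0).value_eq]
    exact_mod_cast hΦ.proxValue_zero_le hmin hs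
  rw [hΦ.coe_toReal_iInf hmin] at hle
  exact fun u _ => hle.trans (iInf_le _ u)

lemma tendsto_prox_zero : Tendsto (fun s => prox Φ s 0) atTop (𝓝 (minNormMinimizer Φ)) := by
  obtain ⟨p, hp⟩ := hΦ.exists_tendsto_prox_zero hmin
  have hnorm : ‖p‖ ≤ ‖minNormMinimizer Φ‖ := by
    refine le_of_tendsto hp.norm ?_
    filter_upwards [eventually_gt_atTop 0] with s hs using hΦ.norm_prox_zero_le hmin hs
  rwa [← hΦ.eq_minNormMinimizer (hΦ.mem_argminSet_of_tendsto_prox_zero hmin hp) hnorm]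

end IsProperConvexLsc

end MinNorm

section RegularizedMinimizer

variable {H : Type*} [NormedAddCommGroup H] [InnerProductSpace ℝ H] [CompleteSpace H]
  {Φ : H → EReal} {e μ : ℝ}

namespace IsProperConvexLsc

variable (hΦ : IsProperConvexLsc Φ) (hmin : (argminSet Φ).Nonempty)
include hΦ hmin

lemma regularized_add_inner_le (hμ : 0 < μ) (x y : H) :
    regularized Φ e μ x + ⟪envGrad Φ μ x + e • x, y - x⟫_ℝ + e / 2 * ‖y - x‖ ^ 2
      + μ / 2 * ‖envGrad Φ μ y - envGrad Φ μ x‖ ^ 2 ≤ regularized Φ e μ y := by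
  have h := hΦ.moreau_add_inner_le hmin hμ x y
  rw [regularized, regularized, inner_add_left, real_inner_smul_left, norm_sub_sq_real,
    real_inner_comm x y, inner_sub_right x, real_inner_self_eq_norm_sq]
  linarith

lemma regularized_sub_add_le_inner (hμ : 0 < μ) (x y : H) :
    regularized Φ e μ x - regularized Φ e μ y + e / 2 * ‖x - y‖ ^ 2
      ≤ ⟪x - y, envGrad Φ μ x + e • x⟫_ℝ := by
  have h := hΦ.regularized_add_inner_le hmin (e := e) hμ x y
  rw [← neg_sub x y, inner_neg_right, norm_neg, real_inner_comm] at h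
  have hdrop : 0 ≤ μ / 2 * ‖envGrad Φ μ y - envGrad Φ μ x‖ ^ 2 := by positivity
  linarith

lemma regularizedMinimizer_eq_of_envGrad_eq (he : 0 < e) (hμ : 0 < μ) {y : H}
    (hy : envGrad Φ μ y = -(e • y)) : regularizedMinimizer Φ e μ = y := by
  have hlower : ∀ x, regularized Φ e μ y + e / 2 * ‖x - y‖ ^ 2 ≤ regularized Φ e μ x := fun x => by
    have h := hΦ.regularized_add_inner_le hmin (e := e) hμ y x
    rw [hy, neg_add_cancel, inner_zero_left, add_zero] at h
    exact (le_add_of_nonneg_right (by positivity)).trans h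
  refine argminOn_eq (mem_univ y)
    (fun x _ => (le_add_of_nonneg_right (by positivity)).trans (hlower x)) fun x _ hx => ?_
  have hzero : ‖x - y‖ ^ 2 ≤ 0 :=
    nonpos_of_mul_nonpos_right (add_le_iff_nonpos_right _ |>.1 ((hlower x).trans hx)) (half_pos he)
  exact sub_eq_zero.1 (norm_eq_zero.1 (pow_eq_zero_iff two_ne_zero |>.1
    (hzero.antisymm (sq_nonneg _))))

/-- The semigroup property of the Moreau envelope, on the level of proximal points. -/
lemma prox_sub_smul_envGrad {ν : ℝ} (hμ : 0 < μ) (hν : 0 < ν) (x : H) :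
    prox Φ μ (x - ν • envGrad Φ (μ + ν) x) = prox Φ (μ + ν) x := by
  have hsub := hΦ.hasSubgradientAt_envGrad hmin (add_pos hμ hν) x
  have hgrad : (1 / μ) • (x - ν • envGrad Φ (μ + ν) x - prox Φ (μ + ν) x)
      = envGrad Φ (μ + ν) x := by
    rw [sub_right_comm, sub_prox (add_pos hμ hν).ne', add_smul, add_sub_cancel_right, smul_smul,
      one_div_mul_cancel hμ.ne', one_smul]
  exact HasSubgradientAt.prox_eq (hgrad.symm ▸ hsub) hμ

lemma envGrad_sub_smul_envGrad {ν : ℝ} (hμ : 0 < μ) (hν : 0 < ν) (x : H) :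
    envGrad Φ μ (x - ν • envGrad Φ (μ + ν) x) = envGrad Φ (μ + ν) x := by
  rw [envGrad, hΦ.prox_sub_smul_envGrad hmin hμ hν, sub_right_comm,
    sub_prox (add_pos hμ hν).ne', add_smul, add_sub_cancel_right, smul_smul,
    one_div_mul_cancel hμ.ne', one_smul]

variable (he : 0 < e) (hμ : 0 < μ)
include he hμ

lemma regularizedMinimizer_eq :
    regularizedMinimizer Φ e μ = -((1 / e) • envGrad Φ (μ + 1 / e) 0) := by
  have hgrad := hΦ.envGrad_sub_smul_envGrad hmin hμ (one_div_pos.2 he) 0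
  rw [zero_sub] at hgrad
  refine hΦ.regularizedMinimizer_eq_of_envGrad_eq hmin he hμ ?_
  rw [hgrad, smul_neg, neg_neg, smul_smul, mul_one_div_cancel he.ne', one_smul]

lemma envGrad_zero_eq :
    envGrad Φ (μ + 1 / e) 0 = -(e • regularizedMinimizer Φ e μ) := by
  rw [hΦ.regularizedMinimizer_eq hmin he hμ, smul_neg, neg_neg, smul_smul,
    mul_one_div_cancel he.ne', one_smul]

lemma prox_regularizedMinimizer :
    prox Φ μ (regularizedMinimizer Φ e μ) = prox Φ (μ + 1 / e) 0 := by
  rw [hΦ.regularizedMinimizer_eq hmin he hμ, ← zero_sub]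
  exact hΦ.prox_sub_smul_envGrad hmin hμ (one_div_pos.2 he) 0

lemma envGrad_regularizedMinimizer :
    envGrad Φ μ (regularizedMinimizer Φ e μ) = -(e • regularizedMinimizer Φ e μ) := by
  rw [← hΦ.envGrad_zero_eq hmin he hμ, hΦ.regularizedMinimizer_eq hmin he hμ, ← zero_sub]
  exact hΦ.envGrad_sub_smul_envGrad hmin hμ (one_div_pos.2 he) 0

lemma regularized_regularizedMinimizer :
    regularized Φ e μ (regularizedMinimizer Φ e μ) = moreau Φ (μ + 1 / e) 0 := by
  have hvalue : proxValue Φ μ (regularizedMinimizer Φ e μ) = proxValue Φ (μ + 1 / e) 0 := by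
    rw [proxValue, proxValue, hΦ.prox_regularizedMinimizer hmin he hμ]
  rw [regularized, hΦ.moreau_eq hmin hμ, hΦ.moreau_eq hmin (by positivity), hvalue,
    hΦ.envGrad_zero_eq hmin he hμ, hΦ.envGrad_regularizedMinimizer hmin he hμ, norm_neg,
    norm_smul, Real.norm_of_nonneg he.le]
  field_simp
  ring

lemma regularized_regularizedMinimizer_add_le (x : H) :
    regularized Φ e μ (regularizedMinimizer Φ e μ)
      + e / 2 * ‖x - regularizedMinimizer Φ e μ‖ ^ 2
      + μ / 2 * ‖envGrad Φ μ x + e • regularizedMinimizer Φ e μ‖ ^ 2 ≤ regularized Φ e μ x := by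
  have h := hΦ.regularized_add_inner_le hmin (e := e) hμ (regularizedMinimizer Φ e μ) x
  rwa [hΦ.envGrad_regularizedMinimizer hmin he hμ, neg_add_cancel, inner_zero_left, add_zero,
    sub_neg_eq_add] at h

lemma regularized_regularizedMinimizer_le_regularized (x : H) :
    regularized Φ e μ (regularizedMinimizer Φ e μ) ≤ regularized Φ e μ x := by
  refine le_trans ?_ (hΦ.regularized_regularizedMinimizer_add_le hmin he hμ x)
  rw [add_assoc]
  exact le_add_of_nonneg_right (by positivity)

lemma norm_regularizedMinimizer_le :
    ‖regularizedMinimizer Φ e μ‖ ≤ ‖minNormMinimizer Φ‖ := by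
  rw [hΦ.regularizedMinimizer_eq hmin he hμ, norm_neg, norm_smul,
    Real.norm_of_nonneg (by positivity)]
  refine le_trans ?_ (hΦ.norm_envGrad_zero_le hmin (s := μ + 1 / e) (by positivity))
  exact mul_le_mul_of_nonneg_right (le_add_of_nonneg_left hμ.le) (norm_nonneg _)

lemma regularized_regularizedMinimizer_le :
    regularized Φ e μ (regularizedMinimizer Φ e μ)
      ≤ (⨅ y, Φ y).toReal + e * ‖minNormMinimizer Φ‖ ^ 2 / 2 := by
  have h := hΦ.regularized_regularizedMinimizer_add_le hmin he hμ (minNormMinimizer Φ)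
  rw [regularized.eq_1 Φ e μ (minNormMinimizer Φ),
    hΦ.moreau_of_mem_argminSet (hΦ.minNormMinimizer_mem hmin) hμ, add_assoc] at h
  exact (le_add_of_nonneg_right (by positivity)).trans h

lemma norm_regularizedMinimizer_sub_le {e' μ' : ℝ} (he' : 0 < e') (hμ' : 0 < μ') :
    ‖regularizedMinimizer Φ e μ - regularizedMinimizer Φ e' μ'‖
      ≤ e' * ‖minNormMinimizer Φ‖ * (|μ - μ'| + 2 * |1 / e - 1 / e'|) := by
  have hr : 0 < μ + 1 / e := by positivity
  have hs : 0 < μ' + 1 / e' := by positivity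
  have hlip := hΦ.envGrad_lipschitz hmin hr hs 0 0
  have hq : ‖envGrad Φ (μ' + 1 / e') 0‖ ≤ e' * ‖minNormMinimizer Φ‖ := by
    have hle := hΦ.norm_regularizedMinimizer_le hmin he' hμ'
    rw [hΦ.envGrad_zero_eq hmin he' hμ', norm_neg, norm_smul, Real.norm_of_nonneg he'.le]
    exact mul_le_mul_of_nonneg_left hle he'.le
  have hindex : |μ' + 1 / e' - (μ + 1 / e)| ≤ |μ - μ'| + |1 / e - 1 / e'| := by
    rw [abs_sub_comm, add_sub_add_comm]
    exact abs_add_le _ _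
  rw [hΦ.regularizedMinimizer_eq hmin he hμ, hΦ.regularizedMinimizer_eq hmin he' hμ']
  rw [sub_self, norm_zero, zero_add] at hlip
  set q := envGrad Φ (μ + 1 / e) 0
  set q' := envGrad Φ (μ' + 1 / e') 0
  have hsplit : -((1 / e) • q) - -((1 / e') • q')
      = -((1 / e) • (q - q') + (1 / e - 1 / e') • q') := by module
  have hfirst : 1 / e * ‖q - q'‖ ≤ (|μ - μ'| + |1 / e - 1 / e'|) * ‖q'‖ :=
    (mul_le_mul_of_nonneg_right (le_add_of_nonneg_left hμ.le) (norm_nonneg _)).trans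
      (hlip.trans (mul_le_mul_of_nonneg_right hindex (norm_nonneg _)))
  calc ‖-((1 / e) • q) - -((1 / e') • q')‖
      ≤ 1 / e * ‖q - q'‖ + |1 / e - 1 / e'| * ‖q'‖ := by
        rw [hsplit, norm_neg]
        refine (norm_add_le _ _).trans_eq ?_
        rw [norm_smul, norm_smul, Real.norm_of_nonneg (by positivity), Real.norm_eq_abs]
    _ ≤ ‖q'‖ * (|μ - μ'| + 2 * |1 / e - 1 / e'|) := by linarith
    _ ≤ e' * ‖minNormMinimizer Φ‖ * (|μ - μ'| + 2 * |1 / e - 1 / e'|) := by gcongr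

end IsProperConvexLsc

end RegularizedMinimizer

section RealCalculus

lemma hasDerivAt_of_squeeze {f g h : ℝ → ℝ} {d a : ℝ} (hg : HasDerivAt g d a)
    (hh : HasDerivAt h d a) (hga : g a = f a) (hha : h a = f a)
    (hgf : ∀ᶠ s in 𝓝 a, g s ≤ f s) (hfh : ∀ᶠ s in 𝓝 a, f s ≤ h s) : HasDerivAt f d a := by
  rw [hasDerivAt_iff_isLittleO] at hg hh ⊢
  refine Asymptotics.IsBigO.trans_isLittleO
    (g := fun s => ‖g s - g a - (s - a) • d‖ + ‖h s - h a - (s - a) • d‖)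
    (Asymptotics.IsBigO.of_bound 1 ?_) (hg.norm_left.add hh.norm_left)
  filter_upwards [hgf, hfh] with s hgfs hfhs
  rw [hga, hha, one_mul, Real.norm_of_nonneg (add_nonneg (norm_nonneg _) (norm_nonneg _)),
    Real.norm_eq_abs, Real.norm_eq_abs, Real.norm_eq_abs]
  refine (abs_le_max_abs_abs (sub_le_sub_right (sub_le_sub_right hgfs (f a)) _)
    (sub_le_sub_right (sub_le_sub_right hfhs (f a)) _)).trans ?_
  exact max_le_add_of_nonneg (abs_nonneg _) (abs_nonneg _)

lemma hasDerivAt_le_add {f g K : ℝ → ℝ} {f' g' k t : ℝ} (hf : HasDerivAt f f' t)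
    (hg : HasDerivAt g g' t) (heq : f t = g t)
    (hle : ∀ᶠ s in 𝓝[>] t, f s ≤ g s + K s * (s - t)) (hK : Tendsto K (𝓝[>] t) (𝓝 k)) :
    f' ≤ g' + k := by
  have hf_slope := (hasDerivWithinAt_iff_tendsto_slope' (notMem_Ioi.2 le_rfl)).1
    (hf.hasDerivWithinAt (s := Ioi t))
  have hg_slope := (hasDerivWithinAt_iff_tendsto_slope' (notMem_Ioi.2 le_rfl)).1
    (hg.hasDerivWithinAt (s := Ioi t))
  refine le_of_tendsto_of_tendsto hf_slope (hg_slope.add hK) ?_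
  filter_upwards [hle, self_mem_nhdsWithin] with s hs hst
  have hpos : 0 < s - t := sub_pos.2 hst
  rw [slope_def_field, slope_def_field, div_add' _ _ _ hpos.ne']
  gcongr
  linarith

lemma le_of_ae_deriv_nonpos {f : ℝ → ℝ} {a b : ℝ} (hab : a ≤ b)
    (hf : AbsolutelyContinuousOnInterval f a b)
    (h : ∀ᵐ t, t ∈ Ioo a b → ∀ f', HasDerivAt f f' t → f' ≤ 0) : f b ≤ f a := by
  have hle : ∫ t in a..b, deriv f t ≤ ∫ _ in a..b, (0 : ℝ) := by
    refine intervalIntegral.integral_mono_ae_restrict hab hf.intervalIntegrable_deriv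
      intervalIntegrable_const ?_
    rw [Measure.restrict_congr_set Ioo_ae_eq_Icc.symm]
    refine (ae_restrict_iff' measurableSet_Ioo).2 ?_
    filter_upwards [h, hf.ae_differentiableAt] with t ht hd hm
    exact ht hm _ (hd (uIcc_of_le hab ▸ Ioo_subset_Icc_self hm)).hasDerivAt
  rw [hf.integral_deriv_eq_sub, intervalIntegral.integral_zero] at hle
  exact sub_nonpos.1 hle

lemma nonpos_of_ae_deriv_nonpos_of_pos {f : ℝ → ℝ} {a b : ℝ} (hab : a ≤ b)
    (hf : AbsolutelyContinuousOnInterval f a b) (ha : f a ≤ 0)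
    (h : ∀ᵐ t, t ∈ Ioo a b → 0 < f t → ∀ f', HasDerivAt f f' t → f' ≤ 0) : f b ≤ 0 := by
  have hcont : ContinuousOn f (Icc a b) := uIcc_of_le hab ▸ hf.continuousOn
  have hcompact : IsCompact (Icc a b ∩ f ⁻¹' Iic 0) :=
    isCompact_Icc.of_isClosed_subset (hcont.preimage_isClosed_of_isClosed isClosed_Icc
      isClosed_Iic) inter_subset_left
  -- after the last point `c` with `f c ≤ 0` the function is positive, hence nonincreasing
  obtain ⟨c, ⟨hc, hfc⟩, hlast⟩ := hcompact.exists_isGreatest ⟨a, left_mem_Icc.2 hab, ha⟩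
  refine le_trans (le_of_ae_deriv_nonpos hc.2 (hf.mono ?_) ?_) hfc
  · rw [uIcc_of_le hc.2, uIcc_of_le hab]
    exact Icc_subset_Icc_left hc.1
  · filter_upwards [h] with t ht htc
    have htab : t ∈ Ioo a b := ⟨hc.1.trans_lt htc.1, htc.2⟩
    exact ht htab (not_le.1 fun hft => htc.1.not_ge (hlast ⟨Ioo_subset_Icc_self htab, hft⟩))

lemma le_deriv_rpow_of_mul_rpow_le {E E' κ C K p r t : ℝ} (ht : 0 < t) (hκ : 0 ≤ κ) (hK : 0 ≤ K)
    (hC : C ≤ κ * K / 2) (hr : r * t ^ (-(1 - p)) ≤ κ / 2) (hle : K * t ^ (-r) ≤ E)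
    (hE' : E' ≤ -(κ * t ^ (-p)) * E + C * t ^ (-(p + r))) :
    E' ≤ K * (-r * t ^ (-r - 1)) := by
  have hsplit : t ^ (-(p + r)) = t ^ (-p) * t ^ (-r) := by
    rw [← Real.rpow_add ht, neg_add]
  have hsplit' : t ^ (-r - 1) = t ^ (-(1 - p)) * t ^ (-(p + r)) := by
    rw [← Real.rpow_add ht]
    ring_nf
  have hpow : 0 ≤ t ^ (-(p + r)) := Real.rpow_nonneg ht.le _
  have hdissipation : κ * t ^ (-p) * (K * t ^ (-r)) ≤ κ * t ^ (-p) * E :=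
    mul_le_mul_of_nonneg_left hle (mul_nonneg hκ (Real.rpow_nonneg ht.le _))
  have hsource := mul_le_mul_of_nonneg_right hC hpow
  have hdrift := mul_le_mul_of_nonneg_right hr (mul_nonneg hK hpow)
  rw [hsplit] at hsource hdrift hE'
  rw [hsplit', hsplit]
  generalize t ^ (-p) = x, t ^ (-r) = y, t ^ (-(1 - p)) = z at *
  linarith

lemma exists_eventually_le_div_rpow {E : ℝ → ℝ} {κ C p r T : ℝ} (hκ : 0 < κ) (hp : p < 1)
    (hac : ∀ᶠ a in atTop, ∀ b ≥ a, AbsolutelyContinuousOnInterval E a b)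
    (hE : ∀ᵐ t, T < t → ∀ E', HasDerivAt E E' t →
      E' ≤ -(κ * t ^ (-p)) * E t + C * t ^ (-(p + r))) :
    ∃ K > 0, ∀ᶠ t in atTop, E t ≤ K / t ^ r := by
  have hsmall : ∀ᶠ t : ℝ in atTop, r * t ^ (-(1 - p)) ≤ κ / 2 := by
    have hlim := (tendsto_rpow_neg_atTop (sub_pos.2 hp)).const_mul r
    rw [mul_zero] at hlim
    exact hlim.eventually_le_const (half_pos hκ)
  obtain ⟨a, ha⟩ := eventually_atTop.1 (hsmall.and ((eventually_gt_atTop 0).and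
    ((eventually_gt_atTop T).and hac)))
  obtain ⟨-, ha0, haT, haE⟩ := ha a le_rfl
  obtain ⟨K, hK⟩ := exists_gt (max 0 (max (2 * C / κ) (E a * a ^ r)))
  obtain ⟨hK0, hCK, haK⟩ : 0 < K ∧ 2 * C / κ < K ∧ E a * a ^ r < K := by
    simpa only [max_lt_iff] using hK
  rw [div_lt_iff₀ hκ] at hCK
  refine ⟨K, hK0, eventually_atTop.2 ⟨a, fun b hb => ?_⟩⟩
  have hbarrier_ac : AbsolutelyContinuousOnInterval (fun t : ℝ => K * t ^ (-r)) a b := by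
    refine ContDiffOn.absolutelyContinuousOnInterval (contDiffOn_const.mul
      (contDiffOn_id.rpow_const_of_ne fun t ht => ?_))
    rw [uIcc_of_le hb] at ht
    exact (ha0.trans_le ht.1).ne'
  rw [div_eq_mul_inv, ← Real.rpow_neg (ha0.trans_le hb).le, ← sub_nonpos]
  refine nonpos_of_ae_deriv_nonpos_of_pos (f := fun t => E t - K * t ^ (-r)) hb
    ((haE b hb).fun_sub hbarrier_ac) ?_ ?_
  · rw [sub_nonpos, Real.rpow_neg ha0.le, ← div_eq_mul_inv,
      le_div_iff₀ (Real.rpow_pos_of_pos ha0 r)]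
    exact haK.le
  filter_upwards [hE] with t hEt ht hpos f' hf'
  obtain ⟨hr, ht0, -, -⟩ := ha t ht.1.le
  have hbarrier : HasDerivAt (fun t : ℝ => K * t ^ (-r)) (K * (-r * t ^ (-r - 1))) t :=
    (Real.hasDerivAt_rpow_const (Or.inl ht0.ne')).const_mul K
  have hEd : HasDerivAt E (f' + K * (-r * t ^ (-r - 1))) t := by
    simpa only [sub_add_cancel] using hf'.fun_add hbarrier
  have hle := le_deriv_rpow_of_mul_rpow_le ht0 hκ.le hK0.le (by linarith) hr (sub_pos.1 hpos).le
    (hEt (haT.trans ht.1) _ hEd)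
  linarith

end RealCalculus

section AbsoluteContinuity

lemma absolutelyContinuousOnInterval_of_dist_le {X Y Z : Type*} [PseudoMetricSpace X]
    [PseudoMetricSpace Y] [PseudoMetricSpace Z] {f : ℝ → X} {g : ℝ → Y} {h : ℝ → Z} {a b A B : ℝ}
    (hg : AbsolutelyContinuousOnInterval g a b) (hh : AbsolutelyContinuousOnInterval h a b)
    (hle : ∀ s ∈ uIcc a b, ∀ t ∈ uIcc a b,
      dist (f s) (f t) ≤ A * dist (g s) (g t) + B * dist (h s) (h t)) :
    AbsolutelyContinuousOnInterval f a b := by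
  unfold AbsolutelyContinuousOnInterval at hg hh ⊢
  have hlim := (hg.const_mul A).add (hh.const_mul B)
  rw [mul_zero, mul_zero, add_zero] at hlim
  refine squeeze_zero' (Eventually.of_forall fun _ => Finset.sum_nonneg fun _ _ => dist_nonneg)
    ?_ hlim
  filter_upwards [mem_inf_of_right (mem_principal_self _)] with E hE
  rw [Finset.mul_sum, Finset.mul_sum, ← Finset.sum_add_distrib]
  refine Finset.sum_le_sum fun i hi => ?_
  obtain ⟨hs, ht⟩ := hE.1 i hi
  exact hle _ hs _ ht

lemma absolutelyContinuousOnInterval_congr {X : Type*} [PseudoMetricSpace X] {f g : ℝ → X}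
    {a b : ℝ} (hg : AbsolutelyContinuousOnInterval g a b) (heq : EqOn f g (uIcc a b)) :
    AbsolutelyContinuousOnInterval f a b :=
  absolutelyContinuousOnInterval_of_dist_le (A := 1) (B := 0) hg hg fun s hs t ht => by
    rw [heq hs, heq ht, one_mul, zero_mul, add_zero]

lemma absolutelyContinuousOnInterval_sq_norm {F : Type*} [SeminormedAddCommGroup F] {f : ℝ → F}
    {a b : ℝ} (hf : AbsolutelyContinuousOnInterval f a b) :
    AbsolutelyContinuousOnInterval (fun t => ‖f t‖ ^ 2) a b := by
  have hnorm : AbsolutelyContinuousOnInterval (fun t => ‖f t‖) a b :=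
    absolutelyContinuousOnInterval_of_dist_le (A := 1) (B := 0) hf hf fun s _ t _ => by
      rw [one_mul, zero_mul, add_zero, dist_eq_norm (f s)]
      exact abs_norm_sub_norm_le _ _
  simpa only [sq] using hnorm.fun_mul hnorm

lemma absolutelyContinuousOnInterval_const {X : Type*} [PseudoMetricSpace X] (c : X) (a b : ℝ) :
    AbsolutelyContinuousOnInterval (fun _ => c) a b :=
  (LipschitzWith.const c).lipschitzOnWith.absolutelyContinuousOnInterval

lemma absolutelyContinuousOnInterval_of_hasDerivAt {F : Type*} [NormedAddCommGroup F]
    [NormedSpace ℝ F] {f f' : ℝ → F} {a b : ℝ} (hf : ∀ t ∈ uIcc a b, HasDerivAt f (f' t) t)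
    (hf' : ContinuousOn f' (uIcc a b)) : AbsolutelyContinuousOnInterval f a b := by
  obtain ⟨C, hC⟩ := isCompact_uIcc.exists_bound_of_continuousOn hf'
  refine LipschitzOnWith.absolutelyContinuousOnInterval (K := C.toNNReal) ?_
  refine (convex_uIcc a b).lipschitzOnWith_of_nnnorm_hasDerivWithin_le
    (fun t ht => (hf t ht).hasDerivWithinAt) fun t ht => ?_
  exact NNReal.le_toNNReal_of_coe_le (hC t ht)

end AbsoluteContinuity

section CurveRegularity

variable {H : Type*} [NormedAddCommGroup H] [InnerProductSpace ℝ H] [CompleteSpace H]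
  {Φ : H → EReal} {lam eps : ℝ → ℝ} {x : ℝ → H} {a b : ℝ}

namespace IsProperConvexLsc

variable (hΦ : IsProperConvexLsc Φ) (hmin : (argminSet Φ).Nonempty)
include hΦ hmin

lemma moreau_sub_le {ν μ M : ℝ} (hν : 0 < ν) (hμ : 0 < μ) {p q : H}
    (hM : ‖envGrad Φ ν p‖ ≤ M) :
    moreau Φ ν p - moreau Φ μ q ≤ M * ‖p - q‖ + M ^ 2 * |ν - μ| := by
  have hlower := hΦ.moreau_lower hmin hν hμ p q
  have hdrop : 0 ≤ μ / 2 * ‖envGrad Φ μ q - envGrad Φ ν p‖ ^ 2 := by positivity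
  have hinner : -⟪envGrad Φ ν p, q - p⟫_ℝ ≤ M * ‖p - q‖ := by
    rw [← inner_neg_right, neg_sub]
    exact (real_inner_le_norm _ _).trans (mul_le_mul_of_nonneg_right hM (norm_nonneg _))
  have hindex : -((ν - μ) / 2 * ‖envGrad Φ ν p‖ ^ 2) ≤ M ^ 2 * |ν - μ| := calc
    -((ν - μ) / 2 * ‖envGrad Φ ν p‖ ^ 2) = ‖envGrad Φ ν p‖ ^ 2 * (-(ν - μ) / 2) := by ring
    _ ≤ ‖envGrad Φ ν p‖ ^ 2 * |ν - μ| := by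
      gcongr
      linarith [neg_abs_le (ν - μ), abs_nonneg (ν - μ)]
    _ ≤ M ^ 2 * |ν - μ| := by gcongr
  linarith

lemma absolutelyContinuousOnInterval_envGrad (hlam : AbsolutelyContinuousOnInterval lam a b)
    (hx : AbsolutelyContinuousOnInterval x a b) (hpos : ∀ t ∈ uIcc a b, 0 < lam t) :
    AbsolutelyContinuousOnInterval (fun t => envGrad Φ (lam t) (x t)) a b := by
  obtain ⟨z, hz⟩ := hmin
  obtain ⟨m, hm, hle⟩ := isCompact_uIcc.exists_forall_le' hlam.continuousOn hpos
  obtain ⟨M, hM⟩ := (hx.fun_sub (absolutelyContinuousOnInterval_const z a b)).exists_bound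
  have hgrad : ∀ t ∈ uIcc a b, ‖envGrad Φ (lam t) (x t)‖ ≤ M / m := fun t ht => by
    rw [le_div_iff₀' hm]
    calc m * ‖envGrad Φ (lam t) (x t)‖ ≤ lam t * ‖envGrad Φ (lam t) (x t)‖ := by
          gcongr; exact hle t ht
      _ ≤ ‖x t - z‖ := hΦ.norm_envGrad_le hz (hpos t ht) (x t)
      _ ≤ M := hM t ht
  refine absolutelyContinuousOnInterval_of_dist_le (A := 1 / m) (B := M / m / m) hx hlam
    fun s hs t ht => ?_
  have hlip := hΦ.envGrad_lipschitz ⟨z, hz⟩ (hpos s hs) (hpos t ht) (x s) (x t)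
  rw [dist_eq_norm, dist_eq_norm, Real.dist_eq, one_div_mul_eq_div, div_mul_eq_mul_div,
    ← add_div, le_div_iff₀' hm]
  calc m * ‖envGrad Φ (lam s) (x s) - envGrad Φ (lam t) (x t)‖
      ≤ lam s * ‖envGrad Φ (lam s) (x s) - envGrad Φ (lam t) (x t)‖ := by
        gcongr; exact hle s hs
    _ ≤ ‖x s - x t‖ + |lam t - lam s| * ‖envGrad Φ (lam t) (x t)‖ := hlip
    _ ≤ ‖x s - x t‖ + M / m * |lam s - lam t| := by
        rw [abs_sub_comm, mul_comm (M / m)]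
        gcongr
        exact hgrad t ht

lemma absolutelyContinuousOnInterval_moreau (hlam : AbsolutelyContinuousOnInterval lam a b)
    (hx : AbsolutelyContinuousOnInterval x a b) (hpos : ∀ t ∈ uIcc a b, 0 < lam t) :
    AbsolutelyContinuousOnInterval (fun t => moreau Φ (lam t) (x t)) a b := by
  obtain ⟨M, hM⟩ := (hΦ.absolutelyContinuousOnInterval_envGrad hmin hlam hx hpos).exists_bound
  refine absolutelyContinuousOnInterval_of_dist_le (A := M) (B := M ^ 2) hx hlam
    fun s hs t ht => ?_
  rw [Real.dist_eq, abs_sub_le_iff]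
  constructor
  · rw [dist_eq_norm, Real.dist_eq]
    exact hΦ.moreau_sub_le hmin (hpos s hs) (hpos t ht) (hM s hs)
  · rw [dist_comm, dist_comm (lam s), dist_eq_norm, Real.dist_eq]
    exact hΦ.moreau_sub_le hmin (hpos t ht) (hpos s hs) (hM t ht)

variable (hlam : ContDiffOn ℝ 1 lam (uIcc a b)) (heps : ContDiffOn ℝ 1 eps (uIcc a b))
  (hlam_pos : ∀ t ∈ uIcc a b, 0 < lam t) (heps_pos : ∀ t ∈ uIcc a b, 0 < eps t)
include hlam heps hlam_pos heps_pos

lemma absolutelyContinuousOnInterval_regularizedMinimizer :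
    AbsolutelyContinuousOnInterval (fun t => regularizedMinimizer Φ (eps t) (lam t)) a b := by
  have hinv : ContDiffOn ℝ 1 (fun t => 1 / eps t) (uIcc a b) :=
    contDiffOn_const.div heps fun t ht => (heps_pos t ht).ne'
  have hgrad := hΦ.absolutelyContinuousOnInterval_envGrad hmin
    (hlam.add hinv).absolutelyContinuousOnInterval (absolutelyContinuousOnInterval_const 0 a b)
    fun t ht => add_pos (hlam_pos t ht) (one_div_pos.2 (heps_pos t ht))
  exact absolutelyContinuousOnInterval_congr
    (hinv.absolutelyContinuousOnInterval.fun_smul hgrad).fun_neg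
    fun t ht => hΦ.regularizedMinimizer_eq hmin (heps_pos t ht) (hlam_pos t ht)

lemma absolutelyContinuousOnInterval_regularized_sub_min
    (hx : AbsolutelyContinuousOnInterval x a b) :
    AbsolutelyContinuousOnInterval (fun t => regularized Φ (eps t) (lam t) (x t)
      - regularized Φ (eps t) (lam t) (regularizedMinimizer Φ (eps t) (lam t))) a b := by
  have hlam_ac := hlam.absolutelyContinuousOnInterval
  have hregularized : ∀ {z : ℝ → H}, AbsolutelyContinuousOnInterval z a b →
      AbsolutelyContinuousOnInterval (fun t => regularized Φ (eps t) (lam t) (z t)) a b :=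
    fun hz => by
      simpa only [regularized, div_eq_inv_mul] using
        (hΦ.absolutelyContinuousOnInterval_moreau hmin hlam_ac hz hlam_pos).fun_add
          ((heps.absolutelyContinuousOnInterval.fun_mul
            (absolutelyContinuousOnInterval_sq_norm hz)).const_mul 2⁻¹)
  exact (hregularized hx).fun_sub (hregularized
    (hΦ.absolutelyContinuousOnInterval_regularizedMinimizer hmin hlam heps hlam_pos heps_pos))

end IsProperConvexLsc

namespace IsStrongSolution

variable {α β γ t₀ t : ℝ} (hx : IsStrongSolution Φ lam eps α β t₀ x)
include hx

lemma hasDerivAt (ht : t₀ < t) : HasDerivAt x (velocity t₀ x t) t :=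
  (hx.differentiableOn t ht.le).hasDerivWithinAt.hasDerivAt (Ici_mem_nhds ht)

lemma absolutelyContinuousOnInterval_velocity (ha : t₀ ≤ a) (hab : a ≤ b) :
    AbsolutelyContinuousOnInterval (velocity t₀ x) a b := by
  refine (hx.velocity_ac b (ha.trans hab)).mono ?_
  rw [uIcc_of_le hab, uIcc_of_le (ha.trans hab)]
  exact Icc_subset_Icc_left ha

lemma absolutelyContinuousOnInterval (ha : t₀ < a) (hab : a ≤ b) :
    AbsolutelyContinuousOnInterval x a b := by
  refine absolutelyContinuousOnInterval_of_hasDerivAt (fun t ht => hx.hasDerivAt ?_)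
    (hx.absolutelyContinuousOnInterval_velocity ha.le hab).continuousOn
  rw [uIcc_of_le hab] at ht
  exact ha.trans_le ht.1

lemma absolutelyContinuousOnInterval_energy (hΦ : IsProperConvexLsc Φ)
    (hmin : (argminSet Φ).Nonempty) (hlam : ContDiffOn ℝ 1 lam (uIcc a b))
    (heps : ContDiffOn ℝ 1 eps (uIcc a b)) (hlam_pos : ∀ t ∈ uIcc a b, 0 < lam t)
    (heps_pos : ∀ t ∈ uIcc a b, 0 < eps t) (ha : t₀ < a) (hab : a ≤ b) :
    AbsolutelyContinuousOnInterval (energy Φ lam eps β γ t₀ x) a b := by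
  have hx_ac := hx.absolutelyContinuousOnInterval ha hab
  have hgrad : AbsolutelyContinuousOnInterval (envelopeGradient Φ lam x) a b :=
    absolutelyContinuousOnInterval_congr (hΦ.absolutelyContinuousOnInterval_envGrad hmin
      hlam.absolutelyContinuousOnInterval hx_ac hlam_pos)
      fun t ht => hΦ.gradient_moreau hmin (hlam_pos t ht) _
  have hsqrt : AbsolutelyContinuousOnInterval (fun t => √(eps t)) a b :=
    (heps.sqrt fun t ht => (heps_pos t ht).ne').absolutelyContinuousOnInterval
  have hy := hΦ.absolutelyContinuousOnInterval_regularizedMinimizer hmin hlam heps hlam_pos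
    heps_pos
  exact (hΦ.absolutelyContinuousOnInterval_regularized_sub_min hmin hlam heps hlam_pos heps_pos
    hx_ac).fun_add ((absolutelyContinuousOnInterval_sq_norm
      ((((hsqrt.const_mul γ).fun_smul (hx_ac.fun_sub hy)).fun_add
        (hx.absolutelyContinuousOnInterval_velocity ha.le hab)).fun_add
        (hgrad.const_smul β))).const_mul (1 / 2))

end IsStrongSolution

end CurveRegularity

section EnergyDerivative

variable {H : Type*} [NormedAddCommGroup H] [InnerProductSpace ℝ H]

-- The curve `y` need not be differentiable: replacing it by its value at `t` gives a
-- differentiable comparison function, and the error is controlled by the majorant `g`.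
lemma deriv_add_half_sq_norm_le {F c g : ℝ → ℝ} {x y u : ℝ → H} {t E' F' c' g' : ℝ} {x' u' : H}
    (hF : HasDerivAt F F' t) (hc : HasDerivAt c c' t) (hx : HasDerivAt x x' t)
    (hu : HasDerivAt u u' t) (hg : HasDerivAt g g' t) (hct : 0 < c t)
    (hy : ∀ᶠ s in 𝓝[>] t, ‖y s - y t‖ ≤ g s - g t)
    (hE : HasDerivAt (fun s => F s + 1 / 2 * ‖c s • (x s - y s) + u s‖ ^ 2) E' t) :
    E' ≤ F' + ⟪c t • (x t - y t) + u t, c' • (x t - y t) + c t • x' + u'⟫_ℝ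
      + c t * ‖c t • (x t - y t) + u t‖ * g' := by
  have hcomparison : HasDerivAt (fun s => F s + 1 / 2 * ‖c s • (x s - y t) + u s‖ ^ 2)
      (F' + ⟪c t • (x t - y t) + u t, c' • (x t - y t) + c t • x' + u'⟫_ℝ) t := by
    refine (hF.add (((hc.smul (hx.sub_const (y t))).add hu).norm_sq.const_mul (1 / 2))).congr_deriv
      ?_
    rw [one_div, inv_mul_cancel_left₀ two_ne_zero, add_comm (c t • x')]
    rfl
  have hg_slope : Tendsto (slope g t) (𝓝[>] t) (𝓝 g') :=
    (hasDerivWithinAt_iff_tendsto_slope' (notMem_Ioi.2 le_rfl)).1 hg.hasDerivWithinAt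
  have hy_tendsto : Tendsto y (𝓝[>] t) (𝓝 (y t)) := by
    rw [tendsto_iff_norm_sub_tendsto_zero]
    refine squeeze_zero' (Eventually.of_forall fun _ => norm_nonneg _) hy ?_
    simpa only [sub_self] using
      (hg.continuousAt.tendsto.mono_left nhdsWithin_le_nhds).sub_const (g t)
  have hc_tendsto := hc.continuousAt.tendsto.mono_left (nhdsWithin_le_nhds (s := Ioi t))
  have hV_tendsto : Tendsto (fun s => c s • (x s - y s) + u s) (𝓝[>] t)
      (𝓝 (c t • (x t - y t) + u t)) :=
    (hc_tendsto.smul ((hx.continuousAt.tendsto.mono_left nhdsWithin_le_nhds).sub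
      hy_tendsto)).add (hu.continuousAt.tendsto.mono_left nhdsWithin_le_nhds)
  refine hasDerivAt_le_add hE hcomparison rfl ?_ ((hc_tendsto.mul hV_tendsto.norm).mul hg_slope)
  filter_upwards [hy, hc_tendsto.eventually_const_lt hct] with s hys hcs
  have hmove : c s • (x s - y t) + u s = (c s • (x s - y s) + u s) + c s • (y s - y t) := by module
  have hinner : -(‖c s • (x s - y s) + u s‖ * (g s - g t))
      ≤ ⟪c s • (x s - y s) + u s, y s - y t⟫_ℝ :=
    neg_le_of_abs_le ((abs_real_inner_le_norm _ _).trans (by gcongr))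
  have hscaled := mul_le_mul_of_nonneg_left hinner hcs.le
  rw [mul_assoc, mul_comm (slope g t s), ← smul_eq_mul (s - t), sub_smul_slope, vsub_eq_sub, hmove,
    norm_add_sq_real _ (c s • (y s - y t)), real_inner_smul_right]
  linarith [sq_nonneg ‖c s • (y s - y t)‖]

variable [CompleteSpace H] {Φ : H → EReal} {lam eps : ℝ → ℝ} {l' e' t : ℝ}

namespace IsProperConvexLsc

variable (hΦ : IsProperConvexLsc Φ) (hmin : (argminSet Φ).Nonempty) (hlam : HasDerivAt lam l' t)
  (hlam_pos : 0 < lam t)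
include hΦ hmin hlam hlam_pos

lemma hasDerivAt_moreau {x : ℝ → H} {x' : H} (hx : HasDerivAt x x' t) :
    HasDerivAt (fun s => moreau Φ (lam s) (x s))
      (⟪envGrad Φ (lam t) (x t), x'⟫_ℝ - l' / 2 * ‖envGrad Φ (lam t) (x t)‖ ^ 2) t := by
  set q := envGrad Φ (lam t) (x t) with hq
  set p := prox Φ (lam t) (x t)
  have hpos : ∀ᶠ s in 𝓝 t, 0 < lam s := hlam.continuousAt.eventually (lt_mem_nhds hlam_pos)
  refine hasDerivAt_of_squeeze
    (g := fun s => moreau Φ (lam t) (x t) + (⟪q, x s - x t⟫_ℝ + (lam t - lam s) / 2 * ‖q‖ ^ 2))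
    (h := fun s => proxValue Φ (lam t) (x t) + ‖x s - p‖ ^ 2 / (2 * lam s)) ?_ ?_ ?_ ?_ ?_ ?_
  · have hinner : HasDerivAt (fun s => ⟪q, x s - x t⟫_ℝ) ⟪q, x'⟫_ℝ t := by
      simpa using (hasDerivAt_const t q).inner ℝ (hx.sub_const (x t))
    have hindex := ((hlam.const_sub (lam t)).div_const 2).mul_const (‖q‖ ^ 2)
    exact ((hinner.add hindex).const_add (moreau Φ (lam t) (x t))).congr_deriv (by ring)
  · have hquot := ((hx.sub_const p).norm_sq.div (hlam.const_mul 2) (by positivity)).const_add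
      (proxValue Φ (lam t) (x t))
    refine hquot.congr_deriv ?_
    rw [sub_prox hlam_pos.ne', norm_smul, mul_pow, Real.norm_eq_abs, sq_abs, real_inner_smul_left,
      ← hq]
    field_simp
  · simp
  · rw [hΦ.moreau_eq hmin hlam_pos, sq_norm_sub_prox hlam_pos.ne', ← hq]
    field_simp
  · filter_upwards [hpos] with s hs
    have hlower := hΦ.moreau_lower hmin hlam_pos hs (x t) (x s)
    have hdrop : 0 ≤ lam s / 2 * ‖envGrad Φ (lam s) (x s) - q‖ ^ 2 := by positivity
    linarith
  · filter_upwards [hpos] with s hs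
    exact hΦ.moreau_le hmin hs (hΦ.hasSubgradientAt_envGrad hmin hlam_pos (x t)).value_eq.le (x s)

variable (heps : HasDerivAt eps e' t)
include heps

lemma hasDerivAt_regularized {x : ℝ → H} {x' : H} (hx : HasDerivAt x x' t) :
    HasDerivAt (fun s => regularized Φ (eps s) (lam s) (x s))
      (⟪envGrad Φ (lam t) (x t) + eps t • x t, x'⟫_ℝ
        - l' / 2 * ‖envGrad Φ (lam t) (x t)‖ ^ 2 + e' / 2 * ‖x t‖ ^ 2) t := by
  refine ((hΦ.hasDerivAt_moreau hmin hlam hlam_pos hx).add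
    ((heps.mul hx.norm_sq).div_const 2)).congr_deriv ?_
  rw [inner_add_left, real_inner_smul_left]
  ring

variable (heps_pos : 0 < eps t)
include heps_pos

lemma hasDerivAt_regularized_regularizedMinimizer :
    HasDerivAt (fun s => regularized Φ (eps s) (lam s) (regularizedMinimizer Φ (eps s) (lam s)))
      ((e' - l' * eps t ^ 2) / 2 * ‖regularizedMinimizer Φ (eps t) (lam t)‖ ^ 2) t := by
  have hindex : HasDerivAt (fun s => lam s + 1 / eps s) (l' - e' / eps t ^ 2) t := by
    simp only [one_div]
    exact (hlam.add (heps.inv heps_pos.ne')).congr_deriv (by ring)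
  have hmoreau := hΦ.hasDerivAt_moreau hmin hindex (add_pos hlam_pos (one_div_pos.2 heps_pos))
    (hasDerivAt_const t (0 : H))
  rw [hΦ.envGrad_zero_eq hmin heps_pos hlam_pos, inner_zero_right, norm_neg, norm_smul, mul_pow,
    Real.norm_eq_abs, sq_abs] at hmoreau
  refine (hmoreau.congr_of_eventuallyEq ?_).congr_deriv ?_
  · filter_upwards [hlam.continuousAt.eventually (lt_mem_nhds hlam_pos),
      heps.continuousAt.eventually (lt_mem_nhds heps_pos)] with s hlam_s heps_s
    exact hΦ.regularized_regularizedMinimizer hmin heps_s hlam_s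
  · field_simp
    ring

lemma eventually_norm_regularizedMinimizer_sub_le (hlam_le : ∀ᶠ s in 𝓝[>] t, lam t ≤ lam s)
    (heps_le : ∀ᶠ s in 𝓝[>] t, eps s ≤ eps t) :
    ∀ᶠ s in 𝓝[>] t,
      ‖regularizedMinimizer Φ (eps s) (lam s) - regularizedMinimizer Φ (eps t) (lam t)‖
        ≤ eps t * ‖minNormMinimizer Φ‖ * (lam s + 2 * (1 / eps s))
          - eps t * ‖minNormMinimizer Φ‖ * (lam t + 2 * (1 / eps t)) := by
  filter_upwards [hlam_le, heps_le,
    nhdsWithin_le_nhds (hlam.continuousAt.eventually (lt_mem_nhds hlam_pos)),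
    nhdsWithin_le_nhds (heps.continuousAt.eventually (lt_mem_nhds heps_pos))]
    with s hlam_le heps_le hlam_s heps_s
  have hinv : 1 / eps t ≤ 1 / eps s := one_div_le_one_div_of_le heps_s heps_le
  have hlip := hΦ.norm_regularizedMinimizer_sub_le hmin heps_s hlam_s heps_pos hlam_pos
  rw [abs_of_nonneg (sub_nonneg.2 hlam_le), abs_of_nonneg (sub_nonneg.2 hinv)] at hlip
  linarith

end IsProperConvexLsc

lemma IsStrongSolution.energy_deriv_le {α β γ t₀ E' : ℝ} {x : ℝ → H} {v q y acc gradDot : H}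
    (hx : IsStrongSolution Φ lam eps α β t₀ x) (hΦ : IsProperConvexLsc Φ)
    (hmin : (argminSet Φ).Nonempty) (hγ : 0 < γ) (ht : t₀ < t)
    (hlam : HasDerivAt lam l' t) (hlam_pos : 0 < lam t) (hlam_le : ∀ᶠ s in 𝓝[>] t, lam t ≤ lam s)
    (heps : HasDerivAt eps e' t) (heps_pos : 0 < eps t) (heps_le : ∀ᶠ s in 𝓝[>] t, eps s ≤ eps t)
    (hacc : HasDerivAt (velocity t₀ x) acc t)
    (hgradDot : HasDerivAt (envelopeGradient Φ lam x) gradDot t)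
    (hv : velocity t₀ x t = v) (hq : envGrad Φ (lam t) (x t) = q)
    (hy : regularizedMinimizer Φ (eps t) (lam t) = y)
    (heq : acc + (α * √(eps t)) • v + β • gradDot + q + eps t • x t = 0)
    (hE : HasDerivAt (energy Φ lam eps β γ t₀ x) E' t) :
    E' ≤ ⟪q + eps t • x t, v⟫_ℝ - l' / 2 * ‖q‖ ^ 2 + e' / 2 * ‖x t‖ ^ 2
      + (l' * eps t ^ 2 - e') / 2 * ‖y‖ ^ 2
      + ⟪(γ * √(eps t)) • (x t - y) + v + β • q, (γ * (e' / (2 * √(eps t)))) • (x t - y)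
        + (γ * √(eps t)) • v - (α * √(eps t)) • v - (q + eps t • x t)⟫_ℝ
      + γ * √(eps t) * ‖(γ * √(eps t)) • (x t - y) + v + β • q‖
        * (eps t * ‖minNormMinimizer Φ‖ * (l' - 2 * (e' / eps t ^ 2))) := by
  have hx' : HasDerivAt x v t := hv ▸ hx.hasDerivAt ht
  have hF := (hΦ.hasDerivAt_regularized hmin hlam hlam_pos heps hx').fun_sub
    (hΦ.hasDerivAt_regularized_regularizedMinimizer hmin hlam hlam_pos heps heps_pos)
  have hg : HasDerivAt (fun s => eps t * ‖minNormMinimizer Φ‖ * (lam s + 2 * (1 / eps s)))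
      (eps t * ‖minNormMinimizer Φ‖ * (l' - 2 * (e' / eps t ^ 2))) t := by
    simp only [one_div]
    exact ((hlam.add ((heps.inv heps_pos.ne').const_mul 2)).const_mul _).congr_deriv (by ring)
  have hu : HasDerivAt (fun s => velocity t₀ x s + β • envelopeGradient Φ lam x s)
      (acc + β • gradDot) t := hacc.add (hgradDot.const_smul β)
  have hacc_eq : acc + β • gradDot = -((α * √(eps t)) • v) - (q + eps t • x t) := by
    rw [← sub_eq_zero, ← heq]
    abel
  have hE' : HasDerivAt (fun s => energy Φ lam eps β γ t₀ x s) E' t := hE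
  simp only [energy] at hE'
  have hgrad : envelopeGradient Φ lam x t = q := hq ▸ hΦ.gradient_moreau hmin hlam_pos (x t)
  have hle := deriv_add_half_sq_norm_le hF ((heps.sqrt heps_pos.ne').const_mul γ) hx' hu hg
    (by positivity) (hΦ.eventually_norm_regularizedMinimizer_sub_le hmin hlam hlam_pos heps
      heps_pos hlam_le heps_le) (by simpa only [add_assoc] using hE')
  rw [hq, hy, hv, hgrad, hacc_eq, ← add_sub_assoc, ← sub_eq_add_neg, ← add_assoc] at hle
  linarith

end EnergyDerivative

section Dissipation

/-- The smallness conditions under which the energy decays at rate `k * s / 2` at time `t`, where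
`s = √(ε t)`. They hold for all large `t` once `k` is small enough. -/
structure DissipationRegime (α β γ k s t : ℝ) : Prop where
  rate_pos : 0 < k
  pos : 0 < s
  time_pos : 0 < t
  sq_mul_le : s ^ 2 * t ≤ 1
  four_le : 4 ≤ t * s
  two_mul_le : 2 * γ ≤ k * (t * s)
  rate_le_gamma : k ≤ γ
  rate_mul_gamma_le : 24 * (k * γ) ≤ 1
  rate_le_gap : 24 * k ≤ α - γ
  rate_mul_beta_le : 24 * (k * β * s) ≤ 1
  beta_mul_gap_le : 16 * (β * (α - γ) * s) ≤ 1

lemma exists_eventually_dissipationRegime {α β γ : ℝ} {s : ℝ → ℝ} (hγ : 0 < γ) (hγα : γ < α)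
    (hs : ∀ᶠ t in atTop, 0 < s t) (hs_zero : Tendsto s atTop (𝓝 0))
    (hs_sq : ∀ᶠ t in atTop, s t ^ 2 * t ≤ 1) (hs_top : Tendsto (fun t => t * s t) atTop atTop) :
    ∃ k, ∀ᶠ t in atTop, DissipationRegime α β γ k (s t) t := by
  have hsmall (a : ℝ) {b : ℝ} (hb : 0 < b) : ∀ᶠ k in 𝓝[>] (0 : ℝ), a * k ≤ b := by
    have hlim : Tendsto (a * ·) (𝓝[>] 0) (𝓝 0) := by
      simpa using ((continuous_const_mul a).tendsto 0).mono_left nhdsWithin_le_nhds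
    exact (hlim.eventually_lt_const hb).mono fun _ => le_of_lt
  obtain ⟨k, hk, hkγ, hkγ', hkα⟩ := ((eventually_mem_nhdsWithin.and ((hsmall 1 hγ).and
    ((hsmall (24 * γ) one_pos).and (hsmall 24 (sub_pos.2 hγα))))).exists : ∃ k : ℝ, _)
  have hk : 0 < k := hk
  have hs_small (a : ℝ) : ∀ᶠ t in atTop, a * s t ≤ 1 := by
    have hlim := hs_zero.const_mul a
    rw [mul_zero] at hlim
    exact (hlim.eventually_lt_const one_pos).mono fun _ => le_of_lt
  refine ⟨k, ?_⟩
  filter_upwards [hs, eventually_gt_atTop 0, hs_sq, hs_top.eventually_ge_atTop 4,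
    (hs_top.const_mul_atTop hk).eventually_ge_atTop (2 * γ), hs_small (24 * (k * β)),
    hs_small (16 * (β * (α - γ)))] with t hst ht hsq hfour htwo hkβ hβα
  exact ⟨hk, hst, ht, hsq, hfour, htwo, by linarith, by linarith, hkα, by linarith, by linarith⟩

lemma abs_mul_div_two_mul_le {γ s t e' : ℝ} (hγ : 0 ≤ γ) (hs : 0 < s) (ht : 0 < t) (he' : e' ≤ 0)
    (he'_le : -e' ≤ 2 * s ^ 2 / t) : |γ * (e' / (2 * s))| ≤ γ * s / t := by
  rw [abs_mul, abs_div, abs_of_nonneg hγ, abs_of_nonpos he', abs_of_pos (by positivity : 0 < 2 * s),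
    mul_div_assoc]
  refine mul_le_mul_of_nonneg_left ?_ hγ
  calc -e' / (2 * s) ≤ 2 * s ^ 2 / t / (2 * s) := by gcongr
    _ = s / t := by field_simp

lemma mul_sub_two_mul_div_sq_le {e e' l' t N : ℝ} (he : 0 < e) (hN : 0 ≤ N) (hl' : l' * e ≤ 2 / t)
    (he' : -e' ≤ 2 * e / t) : e * N * (l' - 2 * (e' / e ^ 2)) ≤ 6 * N / t :=
  calc e * N * (l' - 2 * (e' / e ^ 2)) = (l' * e + 2 * (-e' / e)) * N := by field_simp; ring
    _ ≤ (2 / t + 2 * (2 * e / t / e)) * N := by gcongr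
    _ = 6 * N / t := by field_simp; ring

lemma mul_sq_sub_div_two_mul_sq_le {e e' l' t N r : ℝ} (he : 0 < e) (hr : 0 ≤ r) (hrN : r ≤ N)
    (ht : 0 < t) (hl' : l' * e ≤ 2 / t) (he' : -e' ≤ 2 * e / t) :
    (l' * e ^ 2 - e') / 2 * r ^ 2 ≤ 2 * N ^ 2 * (e / t) := by
  have hcoeff : (l' * e ^ 2 - e') / 2 ≤ 2 * (e / t) := by
    have hscaled := mul_le_mul_of_nonneg_right hl' he.le
    rw [div_mul_eq_mul_div, mul_div_assoc] at hscaled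
    rw [mul_div_assoc] at he'
    linarith
  calc (l' * e ^ 2 - e') / 2 * r ^ 2 ≤ 2 * (e / t) * N ^ 2 := by gcongr
    _ = 2 * N ^ 2 * (e / t) := by ring

variable {H : Type*} [NormedAddCommGroup H]

lemma sq_norm_add_add_le (a b c : H) :
    ‖a + b + c‖ ^ 2 ≤ 3 * (‖a‖ ^ 2 + ‖b‖ ^ 2 + ‖c‖ ^ 2) := by
  have htriangle := pow_le_pow_left₀ (norm_nonneg _) (norm_add₃_le (a := a) (b := b) (c := c)) 2
  linarith [sq_nonneg (‖a‖ - ‖b‖), sq_nonneg (‖b‖ - ‖c‖), sq_nonneg (‖a‖ - ‖c‖)]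

variable [InnerProductSpace ℝ H] {u v w q x p : H} {α β γ δ k s t c b L F : ℝ}

-- The two occurrences of `⟪g, w⟫` cancel, which leaves only terms that can be absorbed.
lemma inner_add_inner_eq (a a' b : ℝ) (u w q g : H) :
    ⟪g, w⟫_ℝ + ⟪a • u + w + β • q, a' • u + a • w - b • w - g⟫_ℝ
      = a' * ⟪a • u + w + β • q, u⟫_ℝ - (b - a) * ⟪a • u + w + β • q, w⟫_ℝ
        - a * ⟪u, g⟫_ℝ - β * ⟪q, g⟫_ℝ := by
  have hg : ⟪a • u + w + β • q, g⟫_ℝ = a * ⟪u, g⟫_ℝ + ⟪g, w⟫_ℝ + β * ⟪q, g⟫_ℝ := by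
    rw [inner_add_left, inner_add_left, real_inner_smul_left, real_inner_smul_left,
      real_inner_comm w g]
  rw [inner_sub_right, inner_sub_right, inner_add_right, real_inner_smul_right,
    real_inner_smul_right, real_inner_smul_right, hg]
  ring

lemma mul_inner_le_of_abs_le (hb : 0 ≤ b) (hc : |c| ≤ b * s) :
    c * ⟪v, u⟫_ℝ ≤ b / 2 * (‖v‖ ^ 2 + (s * ‖u‖) ^ 2) :=
  calc c * ⟪v, u⟫_ℝ ≤ |c| * |⟪v, u⟫_ℝ| := (le_abs_self _).trans (abs_mul _ _).le
    _ ≤ b * s * (‖v‖ * ‖u‖) := mul_le_mul hc (abs_real_inner_le_norm v u) (abs_nonneg _)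
      ((abs_nonneg c).trans hc)
    _ ≤ b / 2 * (‖v‖ ^ 2 + (s * ‖u‖) ^ 2) := by
      linarith [mul_nonneg hb (sq_nonneg (‖v‖ - s * ‖u‖))]

lemma neg_mul_inner_velocity_le (hβ : 0 ≤ β) (hγ : 0 ≤ γ) (hδ : 0 ≤ δ) (hs : 0 ≤ s)
    (hγδ : γ * δ ≤ 1 / 2) (hβδ : 16 * (β * δ * s) ≤ 1) :
    -(δ * s * ⟪(γ * s) • u + w + β • q, w⟫_ℝ)
      ≤ s * (γ / 4 * (s * ‖u‖) ^ 2) - s * (3 / 8 * δ * ‖w‖ ^ 2) + β / 8 * ‖q‖ ^ 2 := by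
  have hposition := neg_le_of_abs_le (abs_real_inner_le_norm u w)
  have hgradient := neg_le_of_abs_le (abs_real_inner_le_norm q w)
  have hposition_sq : -(γ * s * ⟪u, w⟫_ℝ) ≤ γ ^ 2 / 2 * (s * ‖u‖) ^ 2 + ‖w‖ ^ 2 / 2 := by
    linarith [mul_le_mul_of_nonneg_left hposition (mul_nonneg hγ hs),
      sq_nonneg (γ * (s * ‖u‖) - ‖w‖)]
  have hgradient_sq : -(β * ⟪q, w⟫_ℝ) ≤ ‖w‖ ^ 2 / 8 + 2 * β ^ 2 * ‖q‖ ^ 2 := by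
    linarith [mul_le_mul_of_nonneg_left hgradient hβ, sq_nonneg (‖w‖ - 4 * (β * ‖q‖))]
  have hγδ_scaled : γ * δ * (γ * s * (s * ‖u‖) ^ 2) ≤ 1 / 2 * (γ * s * (s * ‖u‖) ^ 2) := by gcongr
  have hβδ_scaled := mul_le_mul_of_nonneg_right hβδ (mul_nonneg hβ (sq_nonneg ‖q‖))
  rw [inner_add_left, inner_add_left, real_inner_smul_left, real_inner_smul_left,
    real_inner_self_eq_norm_sq]
  linarith [mul_le_mul_of_nonneg_left (add_le_add hposition_sq hgradient_sq) (mul_nonneg hδ hs)]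

lemma neg_inner_add_smul_le {e : ℝ} (he : 0 ≤ e) (hqp : 0 ≤ ⟪q, x - p⟫_ℝ) :
    -⟪q, q + e • x⟫_ℝ ≤ -(3 / 4 * ‖q‖ ^ 2) + (e * ‖p‖) ^ 2 := by
  rw [inner_sub_right] at hqp
  have hqx : -(‖q‖ * ‖p‖) ≤ ⟪q, x⟫_ℝ := by
    linarith [neg_le_of_abs_le (abs_real_inner_le_norm q p)]
  rw [inner_add_right, real_inner_self_eq_norm_sq, real_inner_smul_right]
  linarith [mul_le_mul_of_nonneg_left hqx he, sq_nonneg (‖q‖ / 2 - e * ‖p‖)]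

namespace DissipationRegime

variable (h : DissipationRegime α β γ k s t)
include h

lemma sq_sq_le : (s ^ 2) ^ 2 ≤ s ^ 2 / t := by
  rw [le_div_iff₀ h.time_pos]
  linarith [mul_le_mul_of_nonneg_left h.sq_mul_le (sq_nonneg s)]

lemma mul_sq_norm_le (hβ : 0 ≤ β) (hγ : 0 ≤ γ) :
    k * s * ‖(γ * s) • u + w + β • q‖ ^ 2
      ≤ s * (γ / 8 * (s * ‖u‖) ^ 2 + (α - γ) / 8 * ‖w‖ ^ 2) + β / 8 * ‖q‖ ^ 2 := by
  have hs := h.pos.le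
  have hsum := sq_norm_add_add_le ((γ * s) • u) w (β • q)
  rw [norm_smul, norm_smul, mul_pow, mul_pow, Real.norm_eq_abs, Real.norm_eq_abs, sq_abs,
    sq_abs] at hsum
  have hposition := mul_le_mul_of_nonneg_right h.rate_mul_gamma_le
    (by positivity : 0 ≤ γ * s * (s * ‖u‖) ^ 2)
  have hvelocity := mul_le_mul_of_nonneg_right h.rate_le_gap
    (by positivity : 0 ≤ s * ‖w‖ ^ 2)
  have hgradient := mul_le_mul_of_nonneg_right h.rate_mul_beta_le
    (by positivity : 0 ≤ β * ‖q‖ ^ 2)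
  linarith [mul_le_mul_of_nonneg_left hsum (mul_pos h.rate_pos h.pos).le]

lemma mul_inner_le (hγ : 0 ≤ γ) (hc : |c| ≤ γ * s / t) :
    c * ⟪v, u⟫_ℝ ≤ s * (k / 4 * ‖v‖ ^ 2 + γ / 8 * (s * ‖u‖) ^ 2) := by
  have hrate : γ / t ≤ s * (k / 2) := by
    rw [div_le_iff₀ h.time_pos]
    linarith [h.two_mul_le]
  have hgamma : γ / t ≤ s * (γ / 4) := by
    rw [div_le_iff₀ h.time_pos]
    linarith [mul_le_mul_of_nonneg_left h.four_le hγ]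
  have hinner := mul_inner_le_of_abs_le (v := v) (u := u) (div_nonneg hγ h.time_pos.le)
    (hc.trans_eq (mul_div_right_comm γ s t))
  linarith [mul_le_mul_of_nonneg_right hrate (sq_nonneg ‖v‖),
    mul_le_mul_of_nonneg_right hgamma (sq_nonneg (s * ‖u‖))]

lemma mul_norm_mul_le {N V : ℝ} (hγ : 0 ≤ γ) (hV : 0 ≤ V) (hL : L ≤ 6 * N / t) :
    γ * s * V * L ≤ s * (k / 4 * V ^ 2) + 36 * γ ^ 2 / k * N ^ 2 * (s ^ 2 / t) := by
  have hk := h.rate_pos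
  have hs := h.pos
  have ht := h.time_pos
  have hyoung : γ * V * (6 * N / t)
      ≤ k / 4 * V ^ 2 + 36 * γ ^ 2 / k * N ^ 2 * (1 / t) ^ 2 := by
    have hsquare : 0 ≤ 1 / k * (k * V / 2 - 6 * γ * N / t) ^ 2 := by positivity
    have hexpand : 1 / k * (k * V / 2 - 6 * γ * N / t) ^ 2
        = k / 4 * V ^ 2 + 36 * γ ^ 2 / k * N ^ 2 * (1 / t) ^ 2 - γ * V * (6 * N / t) := by
      field_simp
      ring
    linarith
  have hdecay : s * (1 / t) ^ 2 ≤ s ^ 2 / t := by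
    rw [div_pow, one_pow, mul_one_div, div_le_div_iff₀ (by positivity) ht]
    linarith [mul_le_mul_of_nonneg_left h.four_le (mul_pos hs ht).le, mul_pos hs ht]
  calc γ * s * V * L ≤ γ * s * V * (6 * N / t) := by gcongr
    _ ≤ s * (k / 4 * V ^ 2) + 36 * γ ^ 2 / k * N ^ 2 * (s * (1 / t) ^ 2) := by
      linarith [mul_le_mul_of_nonneg_left hyoung hs.le]
    _ ≤ _ := by gcongr

lemma dissipation_le (hβ : 0 ≤ β) (hγ : 0 ≤ γ) (hγα : γ * (α - γ) ≤ 1 / 2) (hF_nonneg : 0 ≤ F)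
    (hF : F + s ^ 2 / 2 * ‖u‖ ^ 2 ≤ ⟪u, q + s ^ 2 • x⟫_ℝ) (hqp : 0 ≤ ⟪q, x - p⟫_ℝ)
    (hc : |c| ≤ γ * s / t) (hL : L ≤ 6 * ‖p‖ / t) (hv : (γ * s) • u + w + β • q = v) :
    ⟪q + s ^ 2 • x, w⟫_ℝ + ⟪v, c • u + (γ * s) • w - (α * s) • w - (q + s ^ 2 • x)⟫_ℝ
        + γ * s * ‖v‖ * L
      ≤ -(k / 2 * s) * (F + 1 / 2 * ‖v‖ ^ 2)
        + (β + 36 * γ ^ 2 / k) * ‖p‖ ^ 2 * (s ^ 2 / t) := by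
  have hk := h.rate_pos
  have hs := h.pos
  have hδ : 0 ≤ α - γ := by linarith [h.rate_le_gap]
  have hcross := h.mul_inner_le (v := v) (u := u) hγ hc
  have hvelocity := neg_mul_inner_velocity_le (u := u) (w := w) (q := q) hβ hγ hδ hs.le hγα
    h.beta_mul_gap_le
  have hposition := mul_le_mul_of_nonneg_left hF (mul_nonneg hγ hs.le)
  have hgradient := mul_le_mul_of_nonneg_left (neg_inner_add_smul_le (sq_nonneg s) hqp) hβ
  have hdecay := mul_le_mul_of_nonneg_left h.sq_sq_le (mul_nonneg hβ (sq_nonneg ‖p‖))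
  have hdrift := h.mul_norm_mul_le hγ (norm_nonneg v) hL
  have habsorb := h.mul_sq_norm_le (u := u) (w := w) (q := q) hβ hγ
  have hgap : k / 2 * s * F ≤ γ * s * F := by
    gcongr
    linarith [h.rate_le_gamma]
  have hw_nonneg : 0 ≤ s * ((α - γ) * ‖w‖ ^ 2) := by positivity
  have hq_nonneg : 0 ≤ β * ‖q‖ ^ 2 := by positivity
  have hv_nonneg : 0 ≤ k * s * ‖v‖ ^ 2 := by positivity
  rw [hv] at hvelocity habsorb
  rw [← hv, inner_add_inner_eq, hv]
  linarith

end DissipationRegime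

variable [CompleteSpace H] {Φ : H → EReal} {lam eps : ℝ → ℝ} {l' e' t₀ E' : ℝ}

lemma IsStrongSolution.energy_deriv_le_of_dissipationRegime {x : ℝ → H} {acc gradDot : H}
    (hx : IsStrongSolution Φ lam eps α β t₀ x) (hΦ : IsProperConvexLsc Φ)
    (hmin : (argminSet Φ).Nonempty) (h : DissipationRegime α β γ k √(eps t) t)
    (hβ : 0 ≤ β) (hγ : 0 < γ) (hγα : γ * (α - γ) ≤ 1 / 2) (ht : t₀ < t)
    (hlam : HasDerivAt lam l' t) (hlam_pos : 0 < lam t) (hlam_le : ∀ᶠ s in 𝓝[>] t, lam t ≤ lam s)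
    (hl' : 0 ≤ l') (hl'_le : l' * eps t ≤ 2 / t)
    (heps : HasDerivAt eps e' t) (heps_le : ∀ᶠ s in 𝓝[>] t, eps s ≤ eps t)
    (he' : e' ≤ 0) (he'_le : -e' ≤ 2 * eps t / t)
    (hacc : HasDerivAt (velocity t₀ x) acc t)
    (hgradDot : HasDerivAt (envelopeGradient Φ lam x) gradDot t)
    (heq : acc + (α * √(eps t)) • velocity t₀ x t + β • gradDot
      + envelopeGradient Φ lam x t + eps t • x t = 0)
    (hE : HasDerivAt (energy Φ lam eps β γ t₀ x) E' t) :
    E' ≤ -(k / 2 * √(eps t)) * energy Φ lam eps β γ t₀ x t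
      + (2 + β + 36 * γ ^ 2 / k) * ‖minNormMinimizer Φ‖ ^ 2 * (eps t / t) := by
  have ht_pos := h.time_pos
  have heps_pos : 0 < eps t := Real.sqrt_pos.1 h.pos
  have hsqrt : √(eps t) ^ 2 = eps t := Real.sq_sqrt heps_pos.le
  have hgrad : envelopeGradient Φ lam x t = envGrad Φ (lam t) (x t) :=
    hΦ.gradient_moreau hmin hlam_pos (x t)
  set N := ‖minNormMinimizer Φ‖
  set y := regularizedMinimizer Φ (eps t) (lam t) with hy
  set q := envGrad Φ (lam t) (x t)
  rw [hgrad] at heq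
  have hderiv := hx.energy_deriv_le hΦ hmin hγ ht hlam hlam_pos hlam_le heps heps_pos heps_le hacc
    hgradDot rfl rfl rfl heq hE
  have hgap := hΦ.regularized_sub_add_le_inner hmin (e := eps t) hlam_pos (x t) y
  have hgap_nonneg := sub_nonneg.2
    (hΦ.regularized_regularizedMinimizer_le_regularized hmin heps_pos hlam_pos (x t))
  have hqp : 0 ≤ ⟪q, x t - minNormMinimizer Φ⟫_ℝ :=
    (by positivity : 0 ≤ lam t * ‖q‖ ^ 2).trans
      (hΦ.mul_sq_norm_envGrad_le_inner (hΦ.minNormMinimizer_mem hmin) hlam_pos (x t))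
  have hc := abs_mul_div_two_mul_le hγ.le h.pos ht_pos he' (hsqrt.symm ▸ he'_le)
  have hL := mul_sub_two_mul_div_sq_le heps_pos (norm_nonneg (minNormMinimizer Φ)) hl'_le he'_le
  have hy_term := mul_sq_sub_div_two_mul_sq_le heps_pos (norm_nonneg y)
    (hΦ.norm_regularizedMinimizer_le hmin heps_pos hlam_pos) ht_pos hl'_le he'_le
  have hdissipation := h.dissipation_le (v := (γ * √(eps t)) • (x t - y) + velocity t₀ x t + β • q)
    hβ hγ.le hγα hgap_nonneg (hsqrt.symm ▸ hgap) hqp hc hL rfl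
  have hq_nonneg : 0 ≤ l' / 2 * ‖q‖ ^ 2 := by positivity
  have hx_nonpos : e' / 2 * ‖x t‖ ^ 2 ≤ 0 :=
    mul_nonpos_of_nonpos_of_nonneg (by linarith) (by positivity)
  rw [energy, hgrad, ← hy]
  rw [hsqrt] at hdissipation
  linarith

end Dissipation

section PowerParameters

variable {d l t : ℝ}

lemma polyLam_pos (l : ℝ) (ht : 0 < t) : 0 < polyLam l t := Real.rpow_pos_of_pos ht l

lemma polyEps_pos (d : ℝ) (ht : 0 < t) : 0 < polyEps d t :=
  one_div_pos.2 (Real.rpow_pos_of_pos ht d)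

lemma polyEps_eq_rpow_neg (d : ℝ) (ht : 0 ≤ t) : polyEps d t = t ^ (-d) := by
  rw [polyEps, Real.rpow_neg ht, one_div]

lemma sqrt_polyEps (d : ℝ) (ht : 0 ≤ t) : √(polyEps d t) = t ^ (-(d / 2)) := by
  rw [polyEps_eq_rpow_neg d ht, Real.sqrt_eq_rpow, ← Real.rpow_mul ht]
  congr 1
  ring

lemma polyLam_mul_polyEps (d l : ℝ) (ht : 0 < t) : polyLam l t * polyEps d t = t ^ (-(d - l)) := by
  rw [polyLam, polyEps_eq_rpow_neg d ht.le, ← Real.rpow_add ht]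
  congr 1
  ring

lemma polyEps_div (d : ℝ) (ht : 0 < t) : polyEps d t / t = t ^ (-(d + 1)) := by
  rw [polyEps_eq_rpow_neg d ht.le, ← Real.rpow_sub_one ht.ne']
  congr 1
  ring

lemma polyEps_mul_le_one (hd : 1 ≤ d) (ht : 1 ≤ t) : polyEps d t * t ≤ 1 := by
  rw [polyEps, one_div_mul_eq_div, div_le_one (by positivity)]
  exact Real.self_le_rpow_of_one_le ht hd

lemma hasDerivAt_polyLam (l : ℝ) (ht : 0 < t) : HasDerivAt (polyLam l) (l * polyLam l t / t) t := by
  refine (Real.hasDerivAt_rpow_const (p := l) (Or.inl ht.ne')).congr_deriv ?_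
  rw [Real.rpow_sub_one ht.ne', polyLam, mul_div_assoc]

lemma hasDerivAt_polyEps (d : ℝ) (ht : 0 < t) :
    HasDerivAt (polyEps d) (-(d * polyEps d t / t)) t := by
  refine ((hasDerivAt_polyLam (-d) ht).congr_of_eventuallyEq ?_).congr_deriv ?_
  · filter_upwards [lt_mem_nhds ht] with s hs using polyEps_eq_rpow_neg d hs.le
  · rw [polyLam, polyEps_eq_rpow_neg d ht.le]
    ring

lemma hasDerivAt_one_div_sqrt_polyEps (d : ℝ) (ht : 0 < t) :
    HasDerivAt (fun s => 1 / √(polyEps d s)) (d / 2 * t ^ (-(1 - d / 2))) t := by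
  rw [neg_sub]
  refine (Real.hasDerivAt_rpow_const (p := d / 2) (Or.inl ht.ne')).congr_of_eventuallyEq ?_
  filter_upwards [lt_mem_nhds ht] with s hs
  rw [sqrt_polyEps d hs.le, Real.rpow_neg hs.le, one_div, inv_inv]

lemma contDiffOn_polyLam (l : ℝ) {s : Set ℝ} (hs : ∀ t ∈ s, 0 < t) : ContDiffOn ℝ 1 (polyLam l) s :=
  contDiffOn_id.rpow_const_of_ne fun t ht => (hs t ht).ne'

lemma contDiffOn_polyEps (d : ℝ) {s : Set ℝ} (hs : ∀ t ∈ s, 0 < t) : ContDiffOn ℝ 1 (polyEps d) s :=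
  contDiffOn_const.div (contDiffOn_polyLam d hs) fun t ht => (polyLam_pos d (hs t ht)).ne'

lemma eventually_polyLam_le (hl : 0 ≤ l) (ht : 0 ≤ t) :
    ∀ᶠ s in 𝓝[>] t, polyLam l t ≤ polyLam l s := by
  filter_upwards [self_mem_nhdsWithin] with s hs using Real.rpow_le_rpow ht (le_of_lt hs) hl

lemma eventually_polyEps_le (hd : 0 ≤ d) (ht : 0 < t) :
    ∀ᶠ s in 𝓝[>] t, polyEps d s ≤ polyEps d t := by
  filter_upwards [eventually_polyLam_le hd ht.le] with s hs
  exact one_div_le_one_div_of_le (polyLam_pos d ht) hs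

lemma tendsto_polyLam_mul_polyEps (hld : l < d) :
    Tendsto (fun t => polyLam l t * polyEps d t) atTop (𝓝 0) := by
  refine (tendsto_rpow_neg_atTop (sub_pos.2 hld)).congr' ?_
  filter_upwards [eventually_gt_atTop 0] with t ht using (polyLam_mul_polyEps d l ht).symm

lemma tendsto_sqrt_polyEps (hd : 0 < d) : Tendsto (fun t => √(polyEps d t)) atTop (𝓝 0) := by
  refine (tendsto_rpow_neg_atTop (half_pos hd)).congr' ?_
  filter_upwards [eventually_ge_atTop 0] with t ht using (sqrt_polyEps d ht).symm

lemma tendsto_mul_sqrt_polyEps (hd : d < 2) :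
    Tendsto (fun t => t * √(polyEps d t)) atTop atTop := by
  refine (tendsto_rpow_atTop (by linarith : 0 < 1 - d / 2)).congr' ?_
  filter_upwards [eventually_gt_atTop 0] with t ht
  rw [sqrt_polyEps d ht.le, sub_eq_add_neg, Real.rpow_one_add' ht.le]
  linarith

end PowerParameters

section ParameterConditions

variable {α β γ d l : ℝ}

lemma exists_gamma (hα : 0 < α) : ∃ γ : ℝ, α / 2 < γ ∧ γ < α ∧ 2 * γ * (α - γ) < 1 := by
  have hcont : Continuous fun γ : ℝ => 2 * γ * (α - γ) := by fun_prop
  have hsmall : ∀ᶠ γ in 𝓝[<] α, 2 * γ * (α - γ) < 1 :=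
    (hcont.continuousAt.eventually_lt_const (by simp)).filter_mono nhdsWithin_le_nhds
  obtain ⟨γ, hγ, hγα⟩ := (hsmall.and (Ioo_mem_nhdsLT (half_lt_self hα))).exists
  exact ⟨γ, hγα.1, hγα.2, hγ⟩

lemma eventually_deriv_one_div_sqrt_polyEps_le {b : ℝ} (hd : d < 2) (hb : 0 < b) :
    ∀ᶠ t in atTop, deriv (fun s => 1 / √(polyEps d s)) t ≤ b := by
  have hlim := (tendsto_rpow_neg_atTop (by linarith : 0 < 1 - d / 2)).const_mul (d / 2)
  rw [mul_zero] at hlim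
  filter_upwards [hlim.eventually_le_const hb, eventually_gt_atTop 0] with t hle ht
  rwa [(hasDerivAt_one_div_sqrt_polyEps d ht).deriv]

lemma mul_deriv_polyEps_div (c d : ℝ) {t : ℝ} (ht : 0 < t) :
    c * deriv (polyEps d) t / (2 * polyEps d t) = -(c * d / 2 * t⁻¹) := by
  have heps := polyEps_pos d ht
  rw [(hasDerivAt_polyEps d ht).deriv]
  field_simp

lemma eventually_deriv_one_div_sqrt_polyEps_le_min {a : ℝ} (hβ : 0 ≤ β) (hγ : 0 ≤ γ) (hd : 0 ≤ d)
    (hd₂ : d < 2) (hαγ : α < 2 * γ) (ha : γ * ((a + 1) / a) < α) :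
    ∀ᶠ t in atTop, deriv (fun s => 1 / √(polyEps d s)) t
      ≤ min (2 * γ - α - γ * β * deriv (polyEps d) t / (2 * polyEps d t))
        (α - γ * ((a + 1) / a)) := by
  filter_upwards [eventually_deriv_one_div_sqrt_polyEps_le hd₂ (sub_pos.2 hαγ),
    eventually_deriv_one_div_sqrt_polyEps_le hd₂ (sub_pos.2 ha), eventually_gt_atTop 0]
    with t hfirst hsecond ht
  rw [mul_deriv_polyEps_div _ _ ht, sub_neg_eq_add]
  exact le_min (hfirst.trans (le_add_of_nonneg_right (by positivity))) hsecond

lemma eventually_mul_polyEps_sub_mul_deriv_nonpos {κ : ℝ} (hκ : κ < 0) (β d : ℝ) :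
    ∀ᶠ t in atTop, κ * polyEps d t - β * deriv (polyEps d) t ≤ 0 := by
  have hlim := (tendsto_inv_atTop_zero.const_mul (β * d)).const_add κ
  rw [mul_zero, add_zero] at hlim
  filter_upwards [hlim.eventually_le_const hκ, eventually_gt_atTop 0] with t hcoeff ht
  have hfactor : κ * polyEps d t - β * deriv (polyEps d) t
      = (κ + β * d * t⁻¹) * polyEps d t := by
    rw [(hasDerivAt_polyEps d ht).deriv]
    ring
  rw [hfactor]
  exact mul_nonpos_of_nonpos_of_nonneg hcoeff (polyEps_pos d ht).le

lemma exists_tendsto_polyEps_mul_self (hβ : β < 1 ∨ 1 < d) (hd : 1 ≤ d) :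
    ∃ L, β * L < d ∧ Tendsto (fun t => polyEps d t * t) atTop (𝓝 L) := by
  rcases hd.eq_or_lt with rfl | hd
  · refine ⟨1, by simpa using hβ, tendsto_const_nhds.congr' ?_⟩
    filter_upwards [eventually_gt_atTop 0] with t ht
    rw [polyEps, Real.rpow_one, one_div_mul_cancel ht.ne']
  · refine ⟨0, by linarith, (tendsto_polyLam_mul_polyEps hd).congr fun t => ?_⟩
    rw [polyLam, Real.rpow_one, mul_comm]

lemma eventually_two_mul_sq_polyEps_add_nonpos (γ : ℝ) (hβ : β < 1 ∨ 1 < d) (hd : 1 ≤ d) :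
    ∀ᶠ t in atTop,
      2 * β * polyEps d t ^ 2 + (2 - γ * β * √(polyEps d t)) * deriv (polyEps d) t ≤ 0 := by
  obtain ⟨L, hL, hlim⟩ := exists_tendsto_polyEps_mul_self hβ hd
  have hsqrt := tendsto_sqrt_polyEps (zero_lt_one.trans_le hd)
  have hcoeff :=
    (hlim.const_mul (2 * β)).sub (((hsqrt.const_mul (γ * β)).const_sub 2).const_mul d)
  have hlimit : 2 * β * L - d * (2 - γ * β * 0) < 0 := by linarith
  filter_upwards [hcoeff.eventually_le_const hlimit, eventually_gt_atTop 0] with t hneg ht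
  have hfactor : 2 * β * polyEps d t ^ 2 + (2 - γ * β * √(polyEps d t)) * deriv (polyEps d) t
      = (2 * β * (polyEps d t * t) - d * (2 - γ * β * √(polyEps d t))) * (polyEps d t / t) := by
    rw [(hasDerivAt_polyEps d ht).deriv]
    field_simp
    ring
  rw [hfactor]
  exact mul_nonpos_of_nonpos_of_nonneg hneg (div_pos (polyEps_pos d ht) ht).le

lemma eventually_mul_sqrt_polyEps_sub_le (c : ℝ) (hβ : 0 < β) (hd : 0 < d) (hl : 0 ≤ l) :
    ∀ᶠ t in atTop, c * β ^ 2 * √(polyEps d t)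
      - 3 * β ^ 2 * deriv (polyEps d) t / (2 * polyEps d t) - deriv (polyLam l) t ≤ β := by
  have hlim := ((tendsto_sqrt_polyEps hd).const_mul (c * β ^ 2)).add
    (tendsto_inv_atTop_zero.const_mul (3 * β ^ 2 * d / 2))
  rw [mul_zero, mul_zero, add_zero] at hlim
  filter_upwards [hlim.eventually_le_const hβ, eventually_gt_atTop 0] with t hle ht
  have hlam := polyLam_pos l ht
  rw [mul_deriv_polyEps_div _ _ ht, sub_neg_eq_add, (hasDerivAt_polyLam l ht).deriv]
  exact (sub_le_self _ (by positivity)).trans hle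

lemma exists_parameterConditions (hβ : 0 < β) (hd₁ : 1 ≤ d) (hd₂ : d < 2) (hl : 0 ≤ l)
    (hld : l < d) (hdβ : d = 1 → β < 1) (hγ₀ : 0 < γ) (hγ : α < 2 * γ) (hγα : γ < α)
    (hγ' : 2 * γ * (α - γ) < 1) :
    ∃ a > 0, ∃ c > 0, ParameterConditions (polyLam l) (polyEps d) α β γ a c := by
  have hd₀ : 0 < d := by linarith
  have hgap : 0 < α - γ := sub_pos.2 hγα
  have hdefect : 0 < 1 - 2 * γ * (α - γ) := sub_pos.2 hγ'
  have hβd : β < 1 ∨ 1 < d := hd₁.eq_or_lt.imp (fun h => hdβ h.symm) id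
  refine ⟨2 * γ / (α - γ), by positivity, 2 * γ / (1 - 2 * γ * (α - γ)),
    div_pos (by positivity) hdefect, tendsto_polyLam_mul_polyEps hld, ?_⟩
  have ha : γ * ((2 * γ / (α - γ) + 1) / (2 * γ / (α - γ))) < α := by
    have heq : γ * ((2 * γ / (α - γ) + 1) / (2 * γ / (α - γ))) = (α + γ) / 2 := by
      field_simp
      ring
    linarith
  have hc : 2 * γ * (α - γ) + γ / (2 * γ / (1 - 2 * γ * (α - γ))) - 1 < 0 := by
    have heq : γ / (2 * γ / (1 - 2 * γ * (α - γ))) = (1 - 2 * γ * (α - γ)) / 2 := by field_simp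
    linarith
  exact (eventually_deriv_one_div_sqrt_polyEps_le_min hβ.le hγ₀.le hd₀.le hd₂ hγ ha).and
    ((eventually_mul_polyEps_sub_mul_deriv_nonpos hc β d).and
      ((eventually_two_mul_sq_polyEps_add_nonpos γ hβd hd₁).and
        (eventually_mul_sqrt_polyEps_sub_le _ hβ hd₀ hl)))

end ParameterConditions

section EnergyDecay

variable {H : Type*} [NormedAddCommGroup H] [InnerProductSpace ℝ H] [CompleteSpace H]
  {Φ : H → EReal} {α β γ d l t₀ : ℝ} {x : ℝ → H}

lemma exists_eventually_dissipationRegime_polyEps (β : ℝ) (hγ : 0 < γ) (hγα : γ < α) (hd₁ : 1 ≤ d)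
    (hd₂ : d < 2) : ∃ k, ∀ᶠ t in atTop, DissipationRegime α β γ k √(polyEps d t) t := by
  refine exists_eventually_dissipationRegime hγ hγα ?_ (tendsto_sqrt_polyEps (by linarith)) ?_
    (tendsto_mul_sqrt_polyEps hd₂)
  · filter_upwards [eventually_gt_atTop 0] with t ht using Real.sqrt_pos.2 (polyEps_pos d ht)
  · filter_upwards [eventually_ge_atTop 1] with t ht
    rw [Real.sq_sqrt (polyEps_pos d (by linarith)).le]
    exact polyEps_mul_le_one hd₁ ht

namespace IsStrongSolution

variable (hx : IsStrongSolution Φ (polyLam l) (polyEps d) α β t₀ x) (hΦ : IsProperConvexLsc Φ)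
  (hmin : (argminSet Φ).Nonempty) (hβ : 0 ≤ β) (hγ : 0 < γ) (hγα : γ < α)
  (hγ' : γ * (α - γ) ≤ 1 / 2) (hl : 0 ≤ l) (hld : l ≤ d) (hd₁ : 1 ≤ d) (hd₂ : d < 2)
include hx hΦ hmin

lemma absolutelyContinuousOnInterval_energy_polyLam_polyEps {a b : ℝ} (ha : t₀ < a) (ha₀ : 0 < a)
    (hab : a ≤ b) :
    AbsolutelyContinuousOnInterval (energy Φ (polyLam l) (polyEps d) β γ t₀ x) a b := by
  have hpos : ∀ t ∈ uIcc a b, 0 < t := fun t ht => by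
    rw [uIcc_of_le hab] at ht
    exact ha₀.trans_le ht.1
  exact hx.absolutelyContinuousOnInterval_energy hΦ hmin (contDiffOn_polyLam l hpos)
    (contDiffOn_polyEps d hpos) (fun t ht => polyLam_pos l (hpos t ht))
    (fun t ht => polyEps_pos d (hpos t ht)) ha hab

include hβ hγ hγ' hl hld hd₂

lemma energy_deriv_le_polyLam_polyEps {k t E' : ℝ} {acc gradDot : H} (hd : 0 ≤ d)
    (h : DissipationRegime α β γ k √(polyEps d t) t) (ht : t₀ < t) (ht₁ : 1 ≤ t)
    (hacc : HasDerivAt (velocity t₀ x) acc t)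
    (hgradDot : HasDerivAt (envelopeGradient Φ (polyLam l) x) gradDot t)
    (heq : acc + (α * √(polyEps d t)) • velocity t₀ x t + β • gradDot
      + envelopeGradient Φ (polyLam l) x t + polyEps d t • x t = 0)
    (hE : HasDerivAt (energy Φ (polyLam l) (polyEps d) β γ t₀ x) E' t) :
    E' ≤ -(k / 2 * √(polyEps d t)) * energy Φ (polyLam l) (polyEps d) β γ t₀ x t
      + (2 + β + 36 * γ ^ 2 / k) * ‖minNormMinimizer Φ‖ ^ 2 * (polyEps d t / t) := by
  have ht₀ := h.time_pos
  have hlam := polyLam_pos l ht₀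
  have heps := polyEps_pos d ht₀
  have hlam_eps : polyLam l t * polyEps d t ≤ 1 := by
    rw [polyLam_mul_polyEps d l ht₀]
    exact Real.rpow_le_one_of_one_le_of_nonpos ht₁ (by linarith)
  refine hx.energy_deriv_le_of_dissipationRegime hΦ hmin h hβ hγ hγ' ht (hasDerivAt_polyLam l ht₀)
    hlam (eventually_polyLam_le hl ht₀.le) (by positivity) ?_ (hasDerivAt_polyEps d ht₀)
    (eventually_polyEps_le hd ht₀) ?_ ?_ hacc hgradDot heq hE
  · rw [div_mul_eq_mul_div]
    gcongr
    nlinarith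
  · exact neg_nonpos.2 (by positivity)
  · rw [neg_neg]
    gcongr

include hγα hd₁

lemma exists_eventually_energy_le : ∃ K > 0, ∀ᶠ t in atTop,
    energy Φ (polyLam l) (polyEps d) β γ t₀ x t ≤ K / t ^ (d / 2 + 1) := by
  obtain ⟨k, hregime⟩ := exists_eventually_dissipationRegime_polyEps β hγ hγα hd₁ hd₂
  obtain ⟨T, hT⟩ := eventually_atTop.1
    (hregime.and ((eventually_gt_atTop t₀).and (eventually_ge_atTop 1)))
  refine exists_eventually_le_div_rpow (p := d / 2) (T := T)
    (C := (2 + β + 36 * γ ^ 2 / k) * ‖minNormMinimizer Φ‖ ^ 2)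
    (half_pos (hT T le_rfl).1.rate_pos) (by linarith) ?_ ?_
  · filter_upwards [eventually_gt_atTop t₀, eventually_gt_atTop 0] with a ha ha₀ b hab
    exact hx.absolutelyContinuousOnInterval_energy_polyLam_polyEps hΦ hmin ha ha₀ hab
  · filter_upwards [(ae_restrict_iff' measurableSet_Ioi).1 hx.equation] with t heq ht E' hE
    obtain ⟨hregime, ht₀, ht₁⟩ := hT t ht.le
    obtain ⟨acc, gradDot, hacc, hgradDot, heq⟩ := heq ht₀
    have hderiv := hx.energy_deriv_le_polyLam_polyEps hΦ hmin hβ hγ hγ' hl hld hd₂ (by linarith)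
      hregime ht₀ ht₁ hacc hgradDot heq hE
    rwa [sqrt_polyEps d hregime.time_pos.le, polyEps_div d hregime.time_pos,
      (by ring : d + 1 = d / 2 + (d / 2 + 1))] at hderiv

end IsStrongSolution

end EnergyDecay

section RegularizationGap

variable {H : Type*} [NormedAddCommGroup H] [InnerProductSpace ℝ H] [CompleteSpace H]
  {Φ : H → EReal} {e μ δ : ℝ} {x : H}

namespace IsProperConvexLsc

variable (hΦ : IsProperConvexLsc Φ) (hmin : (argminSet Φ).Nonempty)
include hΦ hmin

lemma apply_prox_sub_iInf_le {b : ℝ} (hμ : 0 < μ)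
    (hb : moreau Φ μ x - (⨅ y, Φ y).toReal ≤ b) : Φ (prox Φ μ x) - (⨅ y, Φ y) ≤ b := by
  rw [(hΦ.hasSubgradientAt_envGrad hmin hμ x).value_eq, ← hΦ.coe_toReal_iInf hmin,
    ← EReal.coe_sub, EReal.coe_le_coe_iff]
  rw [hΦ.moreau_eq hmin hμ] at hb
  exact (sub_le_sub_right (le_add_of_nonneg_right (by positivity)) _).trans hb

lemma sq_norm_prox_sub_le (hμ : 0 < μ) (x : H) :
    ‖prox Φ μ x - x‖ ^ 2 ≤ 2 * μ * (moreau Φ μ x - (⨅ y, Φ y).toReal) := by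
  have hvalue := hΦ.toReal_iInf_le hmin (hΦ.hasSubgradientAt_envGrad hmin hμ x).value_eq.le
  have hle : μ / 2 * ‖envGrad Φ μ x‖ ^ 2 ≤ moreau Φ μ x - (⨅ y, Φ y).toReal := by
    rw [hΦ.moreau_eq hmin hμ]
    linarith
  rw [norm_sub_rev, sq_norm_sub_prox hμ.ne']
  calc μ ^ 2 * ‖envGrad Φ μ x‖ ^ 2 = 2 * μ * (μ / 2 * ‖envGrad Φ μ x‖ ^ 2) := by ring
    _ ≤ _ := by gcongr

variable (he : 0 < e) (hμ : 0 < μ)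
  (hgap : regularized Φ e μ x - regularized Φ e μ (regularizedMinimizer Φ e μ) ≤ δ)
include he hμ hgap

lemma moreau_sub_le_of_regularized_sub_le :
    moreau Φ μ x - (⨅ y, Φ y).toReal ≤ δ + e * ‖minNormMinimizer Φ‖ ^ 2 / 2 := by
  have hle := hΦ.regularized_regularizedMinimizer_le hmin he hμ
  have hnonneg : 0 ≤ e * ‖x‖ ^ 2 / 2 := by positivity
  rw [regularized.eq_1 Φ e μ x] at hgap
  linarith

lemma sq_norm_sub_regularizedMinimizer_le :
    ‖x - regularizedMinimizer Φ e μ‖ ^ 2 ≤ 2 * δ / e := by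
  have hgrowth := hΦ.regularized_regularizedMinimizer_add_le hmin he hμ x
  have hnonneg : 0 ≤ μ / 2 * ‖envGrad Φ μ x + e • regularizedMinimizer Φ e μ‖ ^ 2 := by positivity
  rw [le_div_iff₀ he]
  linarith

lemma sq_norm_prox_sub_le_of_regularized_sub_le :
    ‖prox Φ μ x - x‖ ^ 2 ≤ 4 * μ * δ + 2 * (μ * e) ^ 2 * ‖minNormMinimizer Φ‖ ^ 2 := by
  set y := regularizedMinimizer Φ e μ
  set q := envGrad Φ μ x
  have hgrowth := hΦ.regularized_regularizedMinimizer_add_le hmin he hμ x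
  have hnonneg : 0 ≤ e / 2 * ‖x - y‖ ^ 2 := by positivity
  have hresidual : μ / 2 * ‖q + e • y‖ ^ 2 ≤ δ := by linarith
  have hy : ‖e • y‖ ≤ e * ‖minNormMinimizer Φ‖ := by
    rw [norm_smul, Real.norm_of_nonneg he.le]
    exact mul_le_mul_of_nonneg_left (hΦ.norm_regularizedMinimizer_le hmin he hμ) he.le
  have hq : ‖q‖ ≤ ‖q + e • y‖ + e * ‖minNormMinimizer Φ‖ := by
    simpa using (norm_sub_le (q + e • y) (e • y)).trans (add_le_add_right hy _)
  rw [norm_sub_rev, sq_norm_sub_prox hμ.ne']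
  calc μ ^ 2 * ‖q‖ ^ 2
      ≤ μ ^ 2 * (2 * (‖q + e • y‖ ^ 2 + (e * ‖minNormMinimizer Φ‖) ^ 2)) := by
        gcongr
        exact (pow_le_pow_left₀ (norm_nonneg q) hq 2).trans add_sq_le
    _ = 4 * μ * (μ / 2 * ‖q + e • y‖ ^ 2) + 2 * (μ * e) ^ 2 * ‖minNormMinimizer Φ‖ ^ 2 := by ring
    _ ≤ _ := by gcongr

end IsProperConvexLsc

end RegularizationGap

section Selection

variable {H : Type*} [NormedAddCommGroup H] [InnerProductSpace ℝ H] [CompleteSpace H]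
  {Φ : H → EReal}

lemma IsProperConvexLsc.tendsto_regularizedMinimizer {ι : Type*} {F : Filter ι} {e μ : ι → ℝ}
    (hΦ : IsProperConvexLsc Φ) (hmin : (argminSet Φ).Nonempty) (he : Tendsto e F (𝓝[>] 0))
    (hμ : ∀ᶠ i in F, 0 < μ i) (hμe : Tendsto (fun i => μ i * e i) F (𝓝 0)) :
    Tendsto (fun i => regularizedMinimizer Φ (e i) (μ i)) F (𝓝 (minNormMinimizer Φ)) := by
  have he₀ : ∀ᶠ i in F, 0 < e i := he.eventually self_mem_nhdsWithin
  have hindex : Tendsto (fun i => μ i + 1 / e i) F atTop := by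
    refine tendsto_atTop_mono' F ?_ (tendsto_inv_nhdsGT_zero.comp he)
    filter_upwards [hμ] with i hi
    rw [one_div]
    exact le_add_of_nonneg_left hi.le
  have hscale : Tendsto (fun i => 1 / (1 + μ i * e i)) F (𝓝 1) := by
    simpa using (hμe.const_add 1).inv₀ (by norm_num)
  have hlim := hscale.smul ((hΦ.tendsto_prox_zero hmin).comp hindex)
  rw [one_smul] at hlim
  refine hlim.congr' ?_
  filter_upwards [he₀, hμ] with i hei hμi
  rw [hΦ.regularizedMinimizer_eq hmin hei hμi, Function.comp_apply, prox_zero Φ (by positivity),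
    smul_neg, smul_smul]
  congr 2
  field_simp
  ring

end Selection

section Rates

variable {H : Type*} [NormedAddCommGroup H] [InnerProductSpace ℝ H] [CompleteSpace H]
  {Φ : H → EReal} {d l t K : ℝ} {x : H}

namespace IsProperConvexLsc

variable (hΦ : IsProperConvexLsc Φ) (hmin : (argminSet Φ).Nonempty)
include hΦ hmin

lemma tendsto_regularizedMinimizer_rpow (hd : 0 < d) (hld : l < d) :
    Tendsto (fun t : ℝ => regularizedMinimizer Φ (1 / t ^ d) (t ^ l)) atTop
      (𝓝 (minNormMinimizer Φ)) := by
  refine hΦ.tendsto_regularizedMinimizer hmin (tendsto_nhdsWithin_iff.2 ⟨?_, ?_⟩) ?_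
    (tendsto_polyLam_mul_polyEps hld)
  · exact tendsto_const_nhds.div_atTop (tendsto_rpow_atTop hd)
  · filter_upwards [eventually_gt_atTop 0] with t ht using polyEps_pos d ht
  · filter_upwards [eventually_gt_atTop 0] with t ht using polyLam_pos l ht

variable (ht : 0 < t) (hgap : regularized Φ (1 / t ^ d) (t ^ l) x
  - regularized Φ (1 / t ^ d) (t ^ l) (regularizedMinimizer Φ (1 / t ^ d) (t ^ l))
    ≤ K / t ^ (d / 2 + 1))
include ht hgap

lemma moreau_sub_le_div_rpow_add :
    moreau Φ (t ^ l) x - (⨅ y, Φ y).toReal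
      ≤ K / t ^ (d / 2 + 1) + 1 / (2 * t ^ d) * ‖minNormMinimizer Φ‖ ^ 2 := by
  refine (hΦ.moreau_sub_le_of_regularized_sub_le hmin (polyEps_pos d ht) (polyLam_pos l ht)
    hgap).trans_eq ?_
  rw [polyEps]
  field_simp

lemma sq_norm_sub_regularizedMinimizer_le_div_rpow :
    ‖x - regularizedMinimizer Φ (1 / t ^ d) (t ^ l)‖ ^ 2 ≤ 2 * K / t ^ (1 - d / 2) := by
  refine (hΦ.sq_norm_sub_regularizedMinimizer_le hmin (polyEps_pos d ht) (polyLam_pos l ht)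
    hgap).trans_eq ?_
  rw [(by ring : d / 2 + 1 = d + (1 - d / 2)), Real.rpow_add ht, polyEps]
  field_simp

lemma sq_norm_prox_sub_le_mul_rpow_add :
    ‖prox Φ (t ^ l) x - x‖ ^ 2
      ≤ 2 * K * t ^ (l - d / 2 - 1) + t ^ (l - d) * ‖minNormMinimizer Φ‖ ^ 2 := by
  have hlam := polyLam_pos l ht
  rw [polyLam] at hlam
  refine (hΦ.sq_norm_prox_sub_le hmin hlam x).trans
    ((mul_le_mul_of_nonneg_left (hΦ.moreau_sub_le_div_rpow_add hmin ht hgap)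
      (by positivity)).trans_eq ?_)
  rw [sub_sub, Real.rpow_sub ht, Real.rpow_sub ht]
  field_simp

omit ht
variable (hK : 0 ≤ K) (ht₁ : 1 ≤ t)
include ht₁ hK

lemma moreau_sub_le_div_rpow (hd : d ≤ 2) :
    moreau Φ (t ^ l) x - (⨅ y, Φ y).toReal ≤ (K + ‖minNormMinimizer Φ‖ ^ 2) / t ^ d := by
  have ht : 0 < t := zero_lt_one.trans_le ht₁
  have hpow : t ^ d ≤ t ^ (d / 2 + 1) := Real.rpow_le_rpow_of_exponent_le ht₁ (by linarith)
  calc moreau Φ (t ^ l) x - (⨅ y, Φ y).toReal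
      ≤ K / t ^ (d / 2 + 1) + 1 / (2 * t ^ d) * ‖minNormMinimizer Φ‖ ^ 2 :=
        hΦ.moreau_sub_le_div_rpow_add hmin ht hgap
    _ ≤ K / t ^ d + 1 / t ^ d * ‖minNormMinimizer Φ‖ ^ 2 := by
        gcongr
        exact le_mul_of_one_le_left (by positivity) one_le_two
    _ = _ := by ring

lemma sq_norm_prox_sub_le_div_rpow {p : ℝ} (hp : p ≤ d / 2 + 1 - l)
    (hpd : p ≤ 2 * (d - l) ∨ minNormMinimizer Φ = 0) :
    ‖prox Φ (t ^ l) x - x‖ ^ 2 ≤ (4 * K + 2 * ‖minNormMinimizer Φ‖ ^ 2) / t ^ p := by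
  have ht : 0 < t := zero_lt_one.trans_le ht₁
  have hgapTerm : t ^ l / t ^ (d / 2 + 1) ≤ t ^ (-p) := by
    rw [← Real.rpow_sub ht]
    exact Real.rpow_le_rpow_of_exponent_le ht₁ (by linarith)
  have htikhonovTerm : (t ^ l * polyEps d t) ^ 2 * ‖minNormMinimizer Φ‖ ^ 2
      ≤ t ^ (-p) * ‖minNormMinimizer Φ‖ ^ 2 := by
    rcases hpd with hpd | hzero
    · gcongr
      rw [← polyLam, polyLam_mul_polyEps d l ht, sq, ← Real.rpow_add ht]
      exact Real.rpow_le_rpow_of_exponent_le ht₁ (by linarith)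
    · simp only [hzero, norm_zero, ne_eq, OfNat.ofNat_ne_zero, not_false_eq_true, zero_pow,
        mul_zero, le_refl]
  calc ‖prox Φ (t ^ l) x - x‖ ^ 2
      ≤ 4 * t ^ l * (K / t ^ (d / 2 + 1))
        + 2 * (t ^ l * polyEps d t) ^ 2 * ‖minNormMinimizer Φ‖ ^ 2 :=
        hΦ.sq_norm_prox_sub_le_of_regularized_sub_le hmin (polyEps_pos d ht) (polyLam_pos l ht)
          hgap
    _ = 4 * K * (t ^ l / t ^ (d / 2 + 1))
        + 2 * ((t ^ l * polyEps d t) ^ 2 * ‖minNormMinimizer Φ‖ ^ 2) := by ring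
    _ ≤ 4 * K * t ^ (-p) + 2 * (t ^ (-p) * ‖minNormMinimizer Φ‖ ^ 2) := by gcongr
    _ = _ := by
        rw [Real.rpow_neg ht.le]
        ring

end IsProperConvexLsc

end Rates

section Trajectory

variable {H : Type*} [NormedAddCommGroup H] [InnerProductSpace ℝ H] [CompleteSpace H]
  {Φ : H → EReal} {α β d l t₀ : ℝ} {x : ℝ → H}

lemma regularized_sub_le_energy (Φ : H → EReal) (lam eps : ℝ → ℝ) (β γ t₀ : ℝ) (x : ℝ → H)
    (t : ℝ) :
    regularized Φ (eps t) (lam t) (x t)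
      - regularized Φ (eps t) (lam t) (regularizedMinimizer Φ (eps t) (lam t))
      ≤ energy Φ lam eps β γ t₀ x t :=
  le_add_of_nonneg_right (by positivity)

lemma IsStrongSolution.tendsto_minNormMinimizer
    (hx : IsStrongSolution Φ (polyLam l) (polyEps d) α β t₀ x) (hΦ : IsProperConvexLsc Φ)
    (hmin : (argminSet Φ).Nonempty) (hα : 0 < α) (hβ : 0 ≤ β) (hl : 0 ≤ l) (hld : l < d)
    (hd₁ : 1 ≤ d) (hd₂ : d < 2) : Tendsto x atTop (𝓝 (minNormMinimizer Φ)) := by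
  obtain ⟨γ, hγ, hγα, hγ'⟩ := exists_gamma hα
  obtain ⟨K, -, hE⟩ := hx.exists_eventually_energy_le hΦ hmin hβ (by linarith) hγα (by linarith)
    hl hld.le hd₁ hd₂
  have hbound : Tendsto (fun t : ℝ => 2 * K / t ^ (1 - d / 2)) atTop (𝓝 0) :=
    tendsto_const_nhds.div_atTop (tendsto_rpow_atTop (by linarith))
  have hsq : Tendsto (fun t => ‖x t - regularizedMinimizer Φ (1 / t ^ d) (t ^ l)‖ ^ 2) atTop
      (𝓝 0) := by
    refine squeeze_zero' (Eventually.of_forall fun _ => sq_nonneg _) ?_ hbound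
    filter_upwards [hE, eventually_gt_atTop 0] with t hEt ht
    exact hΦ.sq_norm_sub_regularizedMinimizer_le_div_rpow hmin ht
      ((regularized_sub_le_energy Φ (polyLam l) (polyEps d) β γ t₀ x t).trans hEt)
  have hsub : Tendsto (fun t => x t - regularizedMinimizer Φ (1 / t ^ d) (t ^ l)) atTop (𝓝 0) := by
    rw [tendsto_zero_iff_norm_tendsto_zero]
    simpa using hsq.sqrt
  simpa using hsub.add (hΦ.tendsto_regularizedMinimizer_rpow hmin (by linarith) hld)

end Trajectory

end TikhonovFlow

theorem mainTheorem3 {H : Type*} [NormedAddCommGroup H] [InnerProductSpace ℝ H] [CompleteSpace H]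
    (Φ : H → EReal) (hΦ : TikhonovFlow.IsProperConvexLsc Φ)
    (hmin : (TikhonovFlow.argminSet Φ).Nonempty)
    (α β t₀ d l : ℝ) (hα : 0 < α) (hβ : 0 < β) (ht₀ : 0 < t₀)
    (hd₁ : 1 ≤ d) (hd₂ : d < 2) (hl₀ : 0 ≤ l) (hld : l < d) :
    -- the conditions can be satisfied
    (∃ γ : ℝ, α / 2 < γ ∧ γ < α ∧ 2 * γ * (α - γ) < 1) ∧
    ((d = 1 → β < 1) → ∀ γ : ℝ, α / 2 < γ → γ < α → 2 * γ * (α - γ) < 1 →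
      ∃ a > 0, ∃ c > 0, TikhonovFlow.ParameterConditions
        (TikhonovFlow.polyLam l) (TikhonovFlow.polyEps d) α β γ a c) ∧
    -- the rates along every solution
    (∀ x : ℝ → H,
      TikhonovFlow.IsStrongSolution Φ (TikhonovFlow.polyLam l) (TikhonovFlow.polyEps d) α β t₀ x →
      (∀ γ : ℝ, α / 2 ≤ γ → γ < α → 2 * γ * (α - γ) < 1 →
        ∃ C₃ > 0, ∃ C₄ > 0, ∃ C₅ > 0, ∃ t₂ ≥ t₀, ∀ t ≥ t₂,
          TikhonovFlow.energy Φ (TikhonovFlow.polyLam l) (TikhonovFlow.polyEps d) β γ t₀ x t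
            ≤ C₃ / t ^ (d / 2 + 1) ∧
          TikhonovFlow.moreau Φ (t ^ l) (x t) - (⨅ y, Φ y).toReal
            ≤ C₃ / t ^ (d / 2 + 1)
              + 1 / (2 * t ^ d) * ‖TikhonovFlow.minNormMinimizer Φ‖ ^ 2 ∧
          Φ (TikhonovFlow.prox Φ (t ^ l) (x t)) - (⨅ y, Φ y)
            ≤ ((C₃ / t ^ (d / 2 + 1)
              + 1 / (2 * t ^ d) * ‖TikhonovFlow.minNormMinimizer Φ‖ ^ 2 : ℝ) : EReal) ∧
          ‖TikhonovFlow.prox Φ (t ^ l) (x t) - x t‖ ^ 2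
            ≤ 2 * C₃ * t ^ (l - d / 2 - 1)
              + t ^ (l - d) * ‖TikhonovFlow.minNormMinimizer Φ‖ ^ 2 ∧
          ‖x t - TikhonovFlow.regularizedMinimizer Φ (1 / t ^ d) (t ^ l)‖ ^ 2
            ≤ C₃ / t ^ (1 - d / 2) ∧
          TikhonovFlow.moreau Φ (t ^ l) (x t) - (⨅ y, Φ y).toReal ≤ C₄ / t ^ d ∧
          Φ (TikhonovFlow.prox Φ (t ^ l) (x t)) - (⨅ y, Φ y) ≤ ((C₄ / t ^ d : ℝ) : EReal) ∧
          ‖TikhonovFlow.prox Φ (t ^ l) (x t) - x t‖ ^ 2 ≤ C₅ / t ^ (d - l) ∧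
          (l ≤ 3 * d / 2 - 1 ∨ TikhonovFlow.minNormMinimizer Φ = 0 →
            ‖TikhonovFlow.prox Φ (t ^ l) (x t) - x t‖ ^ 2 ≤ C₅ / t ^ (d / 2 + 1 - l))) ∧
      Tendsto x atTop (𝓝 (TikhonovFlow.minNormMinimizer Φ))) := by
  refine ⟨TikhonovFlow.exists_gamma hα, fun hdβ γ hγ hγα hγ' =>
    TikhonovFlow.exists_parameterConditions hβ hd₁ hd₂ hl₀ hld hdβ (by linarith) (by linarith)
      hγα hγ', fun x hx => ⟨fun γ hγ hγα hγ' => ?_,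
    hx.tendsto_minNormMinimizer hΦ hmin hα hβ.le hl₀ hld hd₁ hd₂⟩⟩
  obtain ⟨K, hK, hE⟩ := hx.exists_eventually_energy_le hΦ hmin hβ.le (by linarith) hγα
    (by linarith) hl₀ hld.le hd₁ hd₂
  obtain ⟨T, hT⟩ := eventually_atTop.1 (hE.and (eventually_ge_atTop 1))
  refine ⟨2 * K, by positivity, 2 * K + ‖TikhonovFlow.minNormMinimizer Φ‖ ^ 2, by positivity,
    4 * (2 * K) + 2 * ‖TikhonovFlow.minNormMinimizer Φ‖ ^ 2, by positivity, max T t₀,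
    le_max_right _ _, fun t ht => ?_⟩
  obtain ⟨hEK, ht₁⟩ := hT t (le_of_max_le_left ht)
  have ht₀ : 0 < t := zero_lt_one.trans_le ht₁
  have hlam : 0 < t ^ l := Real.rpow_pos_of_pos ht₀ l
  have hdouble : K / t ^ (d / 2 + 1) ≤ 2 * K / t ^ (d / 2 + 1) := by gcongr; linarith
  have hgap := (TikhonovFlow.regularized_sub_le_energy Φ _ _ β γ t₀ x t).trans hEK
  have hgap₂ := hgap.trans hdouble
  have hmoreau := hΦ.moreau_sub_le_div_rpow_add hmin ht₀ hgap₂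
  have hmoreau' := hΦ.moreau_sub_le_div_rpow hmin hgap₂ (by positivity) ht₁ hd₂.le
  have hprox {p : ℝ} := hΦ.sq_norm_prox_sub_le_div_rpow hmin hgap₂ (by positivity) ht₁ (p := p)
  exact ⟨hEK.trans hdouble, hmoreau, hΦ.apply_prox_sub_iInf_le hmin hlam hmoreau,
    hΦ.sq_norm_prox_sub_le_mul_rpow_add hmin ht₀ hgap₂,
    hΦ.sq_norm_sub_regularizedMinimizer_le_div_rpow hmin ht₀ hgap, hmoreau',
    hΦ.apply_prox_sub_iInf_le hmin hlam hmoreau', hprox (by linarith) (.inl (by linarith)),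
    fun hcase => hprox le_rfl (hcase.imp_left fun h => by linarith)⟩
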